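/- **Setting.** Let $h>0$, $M\ge 1$, $m\ge 0$ ($M,m$ integers). Let $F(s)$ be a stable, strictly proper and $P(s)$ a stable, proper scalar rational transfer function, given by real state-space realizations $(A_F,B_F,C_F,0)$ and $(A_P,B_P,C_P,D_P)$ whose state matrices have all eigenvalues in the open left half-plane; they act on signals on $[0,\infty)$ with zero initial state. Let $H(z)=z^{q}H_0(z)$ with $0\le q<M$ and $H_0(z)$ a proper real rational transfer function (a finite-dimensional causal filter; $H$ is causal if $q=0$, and $z$ is the unit advance); no stability of $H$ is assumed. Let $(\mathcal S_{\tau}u)[k]=u(k\tau)$ be the sampler, $\mathcal H_{\tau}$ the zero-order hold with period $\tau$, $({\downarrow}M\,x)[k]=x[kM]$ the downsampler, $\mathbf L_N$ the discrete-time lifting, $(\mathbf L_N v)[k]=(v[kN],\dots,v[kN+N-1])^T$, and $\mathbf S_h$ the generalized sampler, $(\mathbf S_h u)[k]=(u(kh),u(kh+h/M),\dots,u(kh+(M-1)h/M))^T$. The decimation error system is $$\mathcal T_D = e^{-mhs}F-P\,\mathcal H_h\,({\downarrow}M)\,H\,\mathcal S_{h/M}\,F ,$$ where $e^{-mhs}$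 is the delay by $mh$. Put $\widetilde H:=[1\ 0\cdots 0]\,\mathbf L_M H\,\mathbf L_M^{-1}$ and $G_N:=\mathbf L_N\mathcal S_{h/N}\,G\,\mathcal H_{h/N}\mathbf L_N^{-1}$ for an operator $G$ on continuous-time signals. Let $\|\mathcal T\|$ denote the $L^2[0,\infty)$-induced norm (respectively the $\ell^2$-induced norm, for discrete-time systems with vector-valued signals with the Euclidean norm), a value in $[0,\infty]$. **Theorem.** 1. $({\downarrow}M)H=\widetilde H\,\mathbf L_M$; $\widetilde H$ is the input/output operator of a finite-dimensional linear time-invariant discrete-time system with $M$ inputs and one output; $\mathbf L_M\mathcal S_{h/M}=\mathbf S_h$; and hence $\mathcal T_D$ equals the single-rate system $e^{-mhs}F-P\,\mathcal H_h\,\widetilde H\,\mathbf S_h\,F$. 2. There exist finite-dimensional linear time-invariant discrete-time systems $T_{D,N}$, $N=M,2M,\dots$, with $N$ inputs and $N$ outputs, namely the fast-sampling/fast-hold discretizations of $\mathcal T_D$: for $N=Ml$, $l\ge1$, $$T_{D,N}=z^{-m}F_N-P_N\,[1\ \cdots\ 1]^T\,\widetilde H\,S\,F_N=\mathbf L_N\mathcal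 S_{h/N}\,\mathcal T_D\,\mathcal H_{h/N}\mathbf L_N^{-1},$$ where $[1\ \cdots\ 1]^T$ has length $N$ and $S=\mathrm{diag}(p,\dots,p)$ ($M$ blocks) with $p=[1\ 0\cdots0]$ of length $l$, such that $$\lim_{N\to\infty}\|T_{D,N}\|=\|\mathcal T_D\| .$$ -/

import Mathlib

open MeasureTheory Filter Topology
open scoped ENNReal

/-- A single-input/single-output, finite-dimensional, continuous-time linear time-invariant system
`ẋ = A x + B u`, `y = C x + D u`, i.e. a realization of the proper rational transfer function
`C (sI - A)⁻¹ B + D`. -/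
structure CTSystem where
  n : ℕ
  A : Matrix (Fin n) (Fin n) ℝ
  B : Fin n → ℝ
  C : Fin n → ℝ
  D : ℝ

namespace CTSystem

/-- All eigenvalues of the state matrix lie in the open left half-plane. -/
def IsStable (G : CTSystem) : Prop :=
  ∀ μ ∈ spectrum ℂ (G.A.map (algebraMap ℝ ℂ)), μ.re < 0

/-- Input/output operator with zero initial state,
`y(t) = ∫₀ᵗ C e^{A(t-s)} B u(s) ds + D u(t)` for `t ≥ 0`. -/
noncomputable def io (G : CTSystem) (u : ℝ → ℝ) (t : ℝ) : ℝ :=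
  (∫ s in (0 : ℝ)..t, (G.C ⬝ᵥ (NormedSpace.exp ((t - s) • G.A)).mulVec G.B) * u s) + G.D * u t

end CTSystem

/-- A finite-dimensional discrete-time linear time-invariant system with `p` inputs and `q` outputs,
`x[k+1] = A x[k] + B u[k]`, `y[k] = C x[k] + D u[k]`. -/
structure DTSystem (p q : ℕ) where
  n : ℕ
  A : Matrix (Fin n) (Fin n) ℝ
  B : Matrix (Fin n) (Fin p) ℝ
  C : Matrix (Fin q) (Fin n) ℝ
  D : Matrix (Fin q) (Fin p) ℝ

namespace DTSystem

/-- State trajectory from the zero initial state. -/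
def state {p q : ℕ} (G : DTSystem p q) (u : ℕ → Fin p → ℝ) : ℕ → Fin G.n → ℝ
  | 0 => 0
  | k + 1 => G.A.mulVec (G.state u k) + G.B.mulVec (u k)

/-- Input/output operator with zero initial state. -/
def io {p q : ℕ} (G : DTSystem p q) (u : ℕ → Fin p → ℝ) (k : ℕ) : Fin q → ℝ :=
  G.C.mulVec (G.state u k) + G.D.mulVec (u k)

end DTSystem

/-- The norm `(∑ₖ |v[k]|²)^{1/2}` of a vector-valued sequence (Euclidean norm on the values),
equal to `∞` if the sequence is not square summable. -/
noncomputable def l2Norm {p : ℕ} (v : ℕ → Fin p → ℝ) : ℝ≥0∞ :=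
  (∑' k, ∑ i, ‖v k i‖ₑ ^ 2) ^ (1 / 2 : ℝ)

/-- The norm of `L²[0, ∞)`, equal to `∞` if the signal is not square integrable. -/
noncomputable def L2Norm (w : ℝ → ℝ) : ℝ≥0∞ :=
  eLpNorm w 2 (volume.restrict (Set.Ici 0))

/-- The `L²`-induced norm `sup {‖T w‖ / ‖w‖ : w ∈ L²[0, ∞), w ≠ 0}`, a value in `[0, ∞]`. -/
noncomputable def inducedNormL2 (T : (ℝ → ℝ) → ℝ → ℝ) : ℝ≥0∞ :=
  ⨆ (w : ℝ → ℝ) (_ : MemLp w 2 (volume.restrict (Set.Ici 0))) (_ : L2Norm w ≠ 0),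
    L2Norm (T w) / L2Norm w

/-- The `ℓ²`-induced norm `sup {‖T v‖ / ‖v‖ : v ∈ ℓ², v ≠ 0}`, a value in `[0, ∞]`. -/
noncomputable def inducedNorml2 {p q : ℕ} (T : (ℕ → Fin p → ℝ) → ℕ → Fin q → ℝ) : ℝ≥0∞ :=
  ⨆ (v : ℕ → Fin p → ℝ) (_ : l2Norm v ≠ ∞) (_ : l2Norm v ≠ 0), l2Norm (T v) / l2Norm v

/-- The ideal sampler with period `τ`. -/
noncomputable def sampler (τ : ℝ) (u : ℝ → ℝ) (k : ℕ) : ℝ := u (k * τ)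

/-- The zero-order hold with period `τ`: the value on `[kτ, (k+1)τ)` is `v[k]`. -/
noncomputable def hold (τ : ℝ) (v : ℕ → ℝ) (t : ℝ) : ℝ := v ⌊t / τ⌋₊

/-- The continuous-time delay by `τ`, transfer function `e^{-τ s}`. -/
noncomputable def ctDelay (τ : ℝ) (u : ℝ → ℝ) (t : ℝ) : ℝ := if τ ≤ t then u (t - τ) else 0

/-- The discrete-time delay by `m` steps, transfer function `z^{-m}`. -/
def dtDelay {p : ℕ} (m : ℕ) (v : ℕ → Fin p → ℝ) (k : ℕ) : Fin p → ℝ :=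
  if m ≤ k then v (k - m) else 0

/-- The downsampler `↓M`. -/
def downsample (M : ℕ) (x : ℕ → ℝ) (k : ℕ) : ℝ := x (k * M)

/-- The discrete-time lifting: `(v[0], v[1], …)` is cut into blocks of length `N`. -/
def dlift (N : ℕ) (v : ℕ → ℝ) (k : ℕ) (i : Fin N) : ℝ := v (k * N + i)

/-- The inverse of the discrete-time lifting (for `0 < N`). -/
def dliftInv (N : ℕ) (v : ℕ → Fin N → ℝ) (n : ℕ) : ℝ :=
  if hN : 0 < N then v (n / N) ⟨n % N, Nat.mod_lt n hN⟩ else 0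

/-- The generalized sampler `v[k] = (u(kh), u(kh + h/M), …, u(kh + (M-1)h/M))`. -/
noncomputable def gsampler (h : ℝ) (M : ℕ) (u : ℝ → ℝ) (k : ℕ) (i : Fin M) : ℝ :=
  u (k * h + i * (h / M))

/-- The digital filter `H(z) = z^q H₀(z)` acting on scalar sequences, where `H₀` is a
finite-dimensional causal system and `z^q` is the advance by `q` steps. It is causal if `q = 0`. -/
def filterOp (H₀ : DTSystem 1 1) (q : ℕ) (x : ℕ → ℝ) (k : ℕ) : ℝ :=
  H₀.io (fun j _ => x j) (k + q) 0

/-- `H̃ = [1 0 ⋯ 0] 𝐋_M H 𝐋_M⁻¹`. -/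
def liftedFilter (M : ℕ) (H : (ℕ → ℝ) → ℕ → ℝ) (v : ℕ → Fin M → ℝ) (k : ℕ) : ℝ :=
  if hM : 0 < M then dlift M (H (dliftInv M v)) k ⟨0, hM⟩ else 0

/-- The decimation error system
`w ↦ e^{-mhs} F w - P 𝓗_h (↓M) H 𝓢_{h/M} F w`. -/
noncomputable def decimErrorSystem (F P : CTSystem) (H : (ℕ → ℝ) → ℕ → ℝ) (M m : ℕ) (h : ℝ)
    (w : ℝ → ℝ) (t : ℝ) : ℝ :=
  ctDelay (m * h) (F.io w) t
    - P.io (hold h (downsample M (H (sampler (h / M) (F.io w))))) t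

/-- The single-rate system `w ↦ e^{-mhs} F w - P 𝓗_h H̃ 𝐒_h F w`, where `𝐒_h` is the
generalized sampler. -/
noncomputable def singleRateSystem (F P : CTSystem) {M : ℕ} (Ht : (ℕ → Fin M → ℝ) → ℕ → ℝ)
    (m : ℕ) (h : ℝ) (w : ℝ → ℝ) (t : ℝ) : ℝ :=
  ctDelay (m * h) (F.io w) t - P.io (hold h (Ht (gsampler h M (F.io w)))) t

/-- The lifted fast-sampling/fast-hold discretization `𝐋_N 𝓢_{h/N} G 𝓗_{h/N} 𝐋_N⁻¹` of an operator
`G` on continuous-time signals. -/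
noncomputable def fsfh (h : ℝ) (N : ℕ) (G : (ℝ → ℝ) → ℝ → ℝ) (v : ℕ → Fin N → ℝ) :
    ℕ → Fin N → ℝ :=
  dlift N (sampler (h / N) (G (hold (h / N) (dliftInv N v))))

/-- The `M × Ml` block-diagonal matrix `diag(p, …, p)` with `p = [1 0 ⋯ 0]` of length `l`. -/
def samplingMatrix (M l : ℕ) : Matrix (Fin M) (Fin (M * l)) ℝ :=
  Matrix.of fun i j => if (j : ℕ) = i * l then 1 else 0

/-- The column `[1 ⋯ 1]ᵀ` of length `N`. -/
def holdMatrix (N : ℕ) : Matrix (Fin N) (Fin 1) ℝ := Matrix.of fun _ _ => 1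

/-- The operator `z^{-m} F_N - P_N 𝟏 H̃ S F_N` with `N = M l`, where `F_N` and `P_N` are the lifted
fast-sampling/fast-hold discretizations of `F` and `P`. -/
noncomputable def decimDiscretization (F P : CTSystem) (H : (ℕ → ℝ) → ℕ → ℝ) (M l m : ℕ) (h : ℝ)
    (v : ℕ → Fin (M * l) → ℝ) (k : ℕ) : Fin (M * l) → ℝ :=
  dtDelay m (fsfh h (M * l) F.io v) k
    - fsfh h (M * l) P.io
        (fun j => (holdMatrix (M * l)).mulVec fun _ =>
          liftedFilter M H
            (fun i => (samplingMatrix M l).mulVec (fsfh h (M * l) F.io v i)) j) k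

/-! The lifting identities are index bookkeeping. The norm limit compares `T = decimErrorSystem`
with its discretizations on hold signals. For `w = hold τ x`, `τ = h / N`, lifting and holding
change input and output norms by the same factor, so the gain of `fsfh h N T` is the largest ratio
of the norms of `interp τ (T w)` and `w` (`l2Norm_fsfh`, `inducedNorml2_fsfh_le`,
`L2Norm_interp_le`).

Upper bound (`exists_inducedNorml2_le`). Write `T w = f - y`, with `f` the delayed output of `F` and
`y` the output of `P`. Stability of `F` makes the interpolation error of `f` at most a constant
times `τ‖w‖` (`exists_L2Norm_io_le`). Within each period `h`, `y` lies in a fixed finite-dimensional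
space of smooth functions, so its interpolation error is at most a constant times `τ‖y‖`
(`exists_L2Norm_interp_sub_le`). Finally `‖y‖ ≤ ‖f‖ + ‖T w‖`, which is controlled by the gain of
`T`, with no boundedness of the filter or of `P` entering. Hence the limsup of the gains is at most
`‖T‖`.

Lower bound (`inducedNormL2_le_liminf`). Any `w` in L² is a limit of hold signals. As `F` is
strictly proper, its output at each instant is continuous in the input for the L² norm, and each
value of the filter output depends on finitely many samples; so the interpolated outputs converge
pointwise to `T w`, and Fatou's lemma bounds `‖T w‖`. This argument also covers `‖T‖ = ∞`. -/

section Realizable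

/-! ### Realizable operators, their composition and lifting -/

variable {U V Y Z : Type} [AddCommGroup U] [Module ℝ U] [AddCommGroup V] [Module ℝ V]
  [AddCommGroup Y] [Module ℝ Y] [AddCommGroup Z] [Module ℝ Z]

/-- `T` is the input/output operator of a finite-dimensional discrete-time linear time-invariant
system with zero initial state. -/
def Realizable (T : (ℕ → U) → ℕ → Y) : Prop :=
  ∃ (X : Type) (_ : AddCommGroup X) (_ : Module ℝ X) (_ : FiniteDimensional ℝ X)
    (A : X →ₗ[ℝ] X) (B : U →ₗ[ℝ] X) (C : X →ₗ[ℝ] Y) (D : U →ₗ[ℝ] Y),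
    ∀ u : ℕ → U, ∃ x : ℕ → X, x 0 = 0 ∧ (∀ k, x (k + 1) = A (x k) + B (u k)) ∧
      ∀ k, T u k = C (x k) + D (u k)

theorem Realizable.static (L : U →ₗ[ℝ] Y) : Realizable fun (u : ℕ → U) k => L (u k) :=
  ⟨PUnit, inferInstance, inferInstance, inferInstance, 0, 0, 0, L, fun _ =>
    ⟨fun _ => 0, rfl, fun _ => rfl, fun _ => by simp⟩⟩

theorem Realizable.comp {T : (ℕ → V) → ℕ → Y} {S : (ℕ → U) → ℕ → V}
    (hT : Realizable T) (hS : Realizable S) : Realizable fun u => T (S u) := by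
  obtain ⟨X, _, _, _, A, B, C, D, hT⟩ := hT
  obtain ⟨X', _, _, _, A', B', C', D', hS⟩ := hS
  refine ⟨X × X', inferInstance, inferInstance, inferInstance,
    (A.coprod (B ∘ₗ C')).prod (A' ∘ₗ LinearMap.snd ℝ X X'), (B ∘ₗ D').prod B',
    C.coprod (D ∘ₗ C'), D ∘ₗ D', fun u => ?_⟩
  obtain ⟨x', h0', h1', h2'⟩ := hS u
  obtain ⟨x, h0, h1, h2⟩ := hT (S u)
  refine ⟨fun k => (x k, x' k), by simp [h0, h0'], fun k => ?_, fun k => ?_⟩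
  · simp [h1, h1', h2', add_assoc]
  · simp [h2, h2', add_assoc]

theorem Realizable.sub {T S : (ℕ → U) → ℕ → Y} (hT : Realizable T) (hS : Realizable S) :
    Realizable fun u k => T u k - S u k := by
  obtain ⟨X, _, _, _, A, B, C, D, hT⟩ := hT
  obtain ⟨X', _, _, _, A', B', C', D', hS⟩ := hS
  refine ⟨X × X', inferInstance, inferInstance, inferInstance, A.prodMap A', B.prod B',
    C.coprod (-C'), D - D', fun u => ?_⟩
  obtain ⟨x', h0', h1', h2'⟩ := hS u
  obtain ⟨x, h0, h1, h2⟩ := hT u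
  refine ⟨fun k => (x k, x' k), by simp [h0, h0'], fun k => ?_, fun k => ?_⟩
  · simp [h1, h1']
  · simp only [h2, h2', LinearMap.coprod_apply, LinearMap.neg_apply, LinearMap.sub_apply]
    abel

theorem Realizable.dtDelay_one (p : ℕ) : Realizable (dtDelay (p := p) 1) := by
  refine ⟨Fin p → ℝ, inferInstance, inferInstance, inferInstance, 0, LinearMap.id, LinearMap.id, 0,
    fun u => ⟨dtDelay 1 u, by simp [dtDelay], fun k => by simp [dtDelay], fun k => by simp⟩⟩

theorem Realizable.dtDelay (p m : ℕ) : Realizable (dtDelay (p := p) m) := by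
  induction m with
  | zero =>
    have := Realizable.static (LinearMap.id (R := ℝ) (M := Fin p → ℝ))
    convert this using 2 with u
    funext k
    simp [_root_.dtDelay]
  | succ m ih =>
    convert (Realizable.dtDelay_one p).comp ih using 1
    funext u k
    rcases k with _ | k
    · simp [_root_.dtDelay]
    · simp [_root_.dtDelay]

/-- Over a block of length `N` the state is a linear function of the initial state and of the
block of inputs. -/
theorem exists_blockState {X : Type} [AddCommGroup X] [Module ℝ X] (A : X →ₗ[ℝ] X)
    (B : ℝ →ₗ[ℝ] X) (N : ℕ) (j : ℕ) (hj : j ≤ N) :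
    ∃ Φ : X × (Fin N → ℝ) →ₗ[ℝ] X, ∀ (u : ℕ → ℝ) (x : ℕ → X),
      (∀ k, x (k + 1) = A (x k) + B (u k)) → ∀ k, x (k * N + j) = Φ (x (k * N), dlift N u k) := by
  induction j with
  | zero => exact ⟨LinearMap.fst ℝ _ _, fun u x _ k => rfl⟩
  | succ j ih =>
    obtain ⟨Φ, hΦ⟩ := ih (by omega)
    refine ⟨A ∘ₗ Φ + B ∘ₗ LinearMap.proj ⟨j, by omega⟩ ∘ₗ LinearMap.snd ℝ _ _, fun u x hx k => ?_⟩
    rw [← add_assoc, hx, hΦ u x hx]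
    simp [dlift]

theorem dlift_dliftInv {N : ℕ} (hN : 0 < N) (v : ℕ → Fin N → ℝ) : dlift N (dliftInv N v) = v := by
  funext k i
  have h1 : (k * N + i) / N = k := by
    rw [mul_comm, Nat.mul_add_div hN, Nat.div_eq_of_lt i.2, add_zero]
  have h2 : (k * N + i) % N = i := by
    rw [mul_comm, Nat.mul_add_mod, Nat.mod_eq_of_lt i.2]
  simp [dlift, dliftInv, hN, h1, h2]

theorem dliftInv_dlift {N : ℕ} (hN : 0 < N) (v : ℕ → ℝ) : dliftInv N (dlift N v) = v := by
  funext n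
  simp [dlift, dliftInv, hN, Nat.div_add_mod']

/-- The lifted system keeps the state space and reads the state only at block ends; every output
within a block is linear in the state at its start and in the block of inputs. -/
theorem Realizable.lift {T : (ℕ → ℝ) → ℕ → ℝ} (hT : Realizable T) {N : ℕ} (hN : 0 < N) :
    Realizable fun v : ℕ → Fin N → ℝ => dlift N (T (dliftInv N v)) := by
  obtain ⟨X, _, _, _, A, B, C, D, hT⟩ := hT
  choose Φ hΦ using exists_blockState A B N
  let Ψ : X × (Fin N → ℝ) →ₗ[ℝ] (Fin N → ℝ) :=
    LinearMap.pi fun i => C ∘ₗ Φ i i.2.le + D ∘ₗ LinearMap.proj i ∘ₗ LinearMap.snd ℝ _ _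
  refine ⟨X, inferInstance, inferInstance, inferInstance,
    Φ N le_rfl ∘ₗ LinearMap.inl ℝ _ _, Φ N le_rfl ∘ₗ LinearMap.inr ℝ _ _,
    Ψ ∘ₗ LinearMap.inl ℝ _ _, Ψ ∘ₗ LinearMap.inr ℝ _ _, fun v => ?_⟩
  obtain ⟨x, h0, h1, h2⟩ := hT (dliftInv N v)
  refine ⟨fun k => x (k * N), by simp [h0], fun k => ?_, fun k => ?_⟩
  · have := hΦ N le_rfl _ x h1 k
    rw [dlift_dliftInv hN] at this
    simp only [LinearMap.comp_apply, ← map_add, LinearMap.inl_apply, LinearMap.inr_apply,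
      Prod.mk_add_mk, add_zero, zero_add]
    rw [← this]; congr 1; ring
  · simp only [LinearMap.comp_apply, ← map_add, LinearMap.inl_apply, LinearMap.inr_apply,
      Prod.mk_add_mk, add_zero, zero_add]
    funext i
    have := hΦ i i.2.le _ x h1 k
    rw [dlift_dliftInv hN] at this
    have h3 : dliftInv N v (k * N + i) = v k i := congrFun (congrFun (dlift_dliftInv hN v) k) i
    simp [Ψ, dlift, h2, this, h3]

end Realizable

theorem Realizable.of_dtSystem {p q : ℕ} (G : DTSystem p q) : Realizable G.io :=
  ⟨Fin G.n → ℝ, inferInstance, inferInstance, inferInstance, Matrix.mulVecLin G.A,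
    Matrix.mulVecLin G.B, Matrix.mulVecLin G.C, Matrix.mulVecLin G.D, fun u =>
    ⟨G.state u, rfl, fun _ => rfl, fun _ => rfl⟩⟩

theorem Realizable.exists_dtSystem {p q : ℕ} {T : (ℕ → Fin p → ℝ) → ℕ → Fin q → ℝ}
    (hT : Realizable T) : ∃ G : DTSystem p q, G.io = T := by
  obtain ⟨X, _, _, _, A, B, C, D, hT⟩ := hT
  let e : X ≃ₗ[ℝ] (Fin (Module.finrank ℝ X) → ℝ) := (Module.finBasis ℝ X).equivFun
  let G : DTSystem p q :=
    ⟨Module.finrank ℝ X, LinearMap.toMatrix' (e.toLinearMap ∘ₗ A ∘ₗ e.symm.toLinearMap),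
      LinearMap.toMatrix' (e.toLinearMap ∘ₗ B), LinearMap.toMatrix' (C ∘ₗ e.symm.toLinearMap),
      LinearMap.toMatrix' D⟩
  refine ⟨G, funext fun u => ?_⟩
  obtain ⟨x, h0, h1, h2⟩ := hT u
  have hs : ∀ k, G.state u k = e (x k) := by
    intro k
    induction k with
    | zero => simp [DTSystem.state, h0]
    | succ k ih =>
      rw [DTSystem.state, ih, h1]
      simp [G, LinearMap.toMatrix'_mulVec]
  funext k
  rw [DTSystem.io, hs, h2]
  simp [G, LinearMap.toMatrix'_mulVec]

theorem Realizable.filterOp (H₀ : DTSystem 1 1) : Realizable (filterOp H₀ 0) := by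
  have h1 := Realizable.static
    (LinearMap.pi fun _ => LinearMap.id : ℝ →ₗ[ℝ] (Fin 1 → ℝ))
  have h2 := Realizable.static (LinearMap.proj 0 : (Fin 1 → ℝ) →ₗ[ℝ] ℝ)
  exact h2.comp ((Realizable.of_dtSystem H₀).comp h1)

/-- The advance by `q < M` steps stays inside the current block, so it amounts to reading entry `q`
instead of entry `0` of the lifted causal filter. This is why the lifted filter is causal although
the filter itself need not be. -/
theorem liftedFilter_eq_dlift (H₀ : DTSystem 1 1) {q M : ℕ} (hq : q < M) (v : ℕ → Fin M → ℝ)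
    (k : ℕ) : liftedFilter M (filterOp H₀ q) v k
      = dlift M (filterOp H₀ 0 (dliftInv M v)) k ⟨q, hq⟩ := by
  simp [liftedFilter, Nat.zero_lt_of_lt hq, dlift, filterOp]

theorem Realizable.liftedFilter (H₀ : DTSystem 1 1) {q M : ℕ} (hq : q < M) :
    Realizable (liftedFilter M (_root_.filterOp H₀ q)) := by
  have h2 := Realizable.static (LinearMap.proj ⟨q, hq⟩ : (Fin M → ℝ) →ₗ[ℝ] ℝ)
  have h3 := h2.comp ((Realizable.filterOp H₀).lift (Nat.zero_lt_of_lt hq))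
  convert h3 using 2 with v
  funext k
  exact liftedFilter_eq_dlift H₀ hq v k

/-! ### Lifting identities and the exact form of the discretization -/

theorem downsample_eq_liftedFilter (H : (ℕ → ℝ) → ℕ → ℝ) {M : ℕ} (hM : 0 < M) (x : ℕ → ℝ) :
    downsample M (H x) = liftedFilter M H (dlift M x) := by
  funext k
  simp [downsample, liftedFilter, hM, dliftInv_dlift hM, dlift]

theorem dlift_sampler_eq_gsampler {M : ℕ} (hM : 0 < M) (h : ℝ) (u : ℝ → ℝ) :
    dlift M (sampler (h / M) u) = gsampler h M u := by
  funext k i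
  have : (M : ℝ) ≠ 0 := by positivity
  simp only [dlift, sampler, gsampler]
  congr 1
  push_cast
  field_simp

theorem decimErrorSystem_eq_singleRateSystem (F P : CTSystem) (H : (ℕ → ℝ) → ℕ → ℝ) {M : ℕ}
    (hM : 0 < M) (m : ℕ) (h : ℝ) :
    decimErrorSystem F P H M m h = singleRateSystem F P (liftedFilter M H) m h := by
  funext w t
  rw [decimErrorSystem, singleRateSystem, downsample_eq_liftedFilter H hM,
    dlift_sampler_eq_gsampler hM]

/-- A hold of a block-constant sequence is a hold with the block period. -/
theorem hold_dliftInv_const {h : ℝ} {N : ℕ} (hN : 0 < N) (c : ℕ → ℝ) :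
    hold (h / N) (dliftInv N fun k _ => c k) = hold h c := by
  funext t
  have h1 : ⌊t / (h / N)⌋₊ / N = ⌊t / h⌋₊ := by
    rw [← Nat.floor_div_natCast]
    congr 1
    have : (N : ℝ) ≠ 0 := by positivity
    field_simp
  simp [hold, dliftInv, hN, h1]

theorem samplingMatrix_mulVec_dlift {M l : ℕ} (hl : 0 < l) (h : ℝ) (f : ℝ → ℝ) (k : ℕ) :
    (samplingMatrix M l).mulVec (dlift (M * l) (sampler (h / (M * l : ℕ)) f) k)
      = dlift M (sampler (h / M) f) k := by
  funext a
  have hb : (a : ℕ) * l < M * l := Nat.mul_lt_mul_of_pos_right a.2 hl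
  rw [Matrix.mulVec, dotProduct, Finset.sum_eq_single ⟨a * l, hb⟩]
  · simp only [samplingMatrix, Matrix.of_apply, if_true, one_mul, dlift, sampler]
    congr 1
    have : (l : ℝ) ≠ 0 := by positivity
    have : (M : ℝ) ≠ 0 := by
      have := a.pos
      positivity
    push_cast
    field_simp
  · intro b _ hb'
    have : (b : ℕ) ≠ a * l := fun h => hb' (Fin.ext h)
    simp [samplingMatrix, this]
  · simp

theorem dtDelay_fsfh {h : ℝ} (hh : 0 < h) {N : ℕ} (hN : 0 < N) (m : ℕ) (f : ℝ → ℝ) :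
    dtDelay m (dlift N (sampler (h / N) f)) = dlift N (sampler (h / N) (ctDelay (m * h) f)) := by
  funext k i
  have hN' : (0 : ℝ) < N := by positivity
  -- Since `i < N`, the fast instant `k * N + i` has passed `m * N` exactly when its whole block
  -- has, so the delay shifts entire blocks.
  have key : (m * h ≤ ((k * N + i : ℕ) : ℝ) * (h / N)) ↔ m ≤ k := by
    rw [show (m * h ≤ ((k * N + i : ℕ) : ℝ) * (h / N)) ↔ m * N ≤ k * N + i from ?_]
    · constructor
      · intro h1
        by_contra! h2
        have : (k + 1) * N ≤ m * N := Nat.mul_le_mul_right N h2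
        have := i.2
        rw [add_mul] at *
        omega
      · intro h1
        exact (Nat.mul_le_mul_right N h1).trans (Nat.le_add_right _ _)
    · rw [mul_div_assoc', le_div_iff₀ hN', ← Nat.cast_le (α := ℝ)]
      push_cast
      rw [show (m : ℝ) * h * N = m * N * h by ring]
      exact mul_le_mul_iff_left₀ hh
  simp only [dtDelay, dlift, sampler, ctDelay, key]
  split_ifs with h1
  · simp only [dlift, sampler]
    congr 1
    push_cast [Nat.cast_sub h1]
    field_simp
    ring
  · rfl

/-- The identity is exact because the input of `P` is constant on periods of length `h`, hence is
also a fast hold, and the instants used by the filter are among the fast sampling instants. -/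
theorem decimDiscretization_eq_fsfh (F P : CTSystem) (H : (ℕ → ℝ) → ℕ → ℝ) {M l : ℕ} (m : ℕ)
    {h : ℝ} (hh : 0 < h) (hM : 0 < M) (hl : 0 < l) :
    decimDiscretization F P H M l m h = fsfh h (M * l) (decimErrorSystem F P H M m h) := by
  have hN : 0 < M * l := Nat.mul_pos hM hl
  funext v k i
  have h1 := congrFun (congrFun (dtDelay_fsfh hh hN m
    (F.io (hold (h / (M * l : ℕ)) (dliftInv (M * l) v)))) k) i
  have h2 : ∀ c : ℕ → ℝ, (fun j => (holdMatrix (M * l)).mulVec fun _ => c j)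
      = fun j _ => c j := by
    intro c
    funext j a
    simp [holdMatrix, Matrix.mulVec, dotProduct]
  simp only [decimDiscretization, Pi.sub_apply, h2]
  simp only [fsfh, hold_dliftInv_const hN, samplingMatrix_mulVec_dlift hl]
  rw [h1, ← downsample_eq_liftedFilter H hM]
  rfl

/-! ### Matrix exponential and the flow of the state equation -/

open scoped Matrix.Norms.Operator in
theorem hasDerivAt_expm {n : ℕ} (A : Matrix (Fin n) (Fin n) ℝ) (t : ℝ) :
    HasDerivAt (fun t : ℝ => NormedSpace.exp (t • A)) (NormedSpace.exp (t • A) * A) t := 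
  hasDerivAt_exp_smul_const A t

open scoped Matrix.Norms.Operator in
theorem exists_norm_expm_le {n : ℕ} (A : Matrix (Fin n) (Fin n) ℝ) (R : ℝ) :
    ∃ K : ℝ, 0 ≤ K ∧ ∀ t ∈ Set.Icc (-R) R, ‖NormedSpace.exp (t • A)‖ ≤ K := by
  have hc : Continuous (fun t : ℝ => ‖NormedSpace.exp (t • A)‖) :=
    Continuous.norm <| continuous_iff_continuousAt.2 fun t => (hasDerivAt_expm A t).continuousAt
  obtain ⟨K, hK⟩ := (isCompact_Icc (a := -R) (b := R)).bddAbove_image hc.continuousOn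
  exact ⟨max K 0, le_max_right _ _, fun t ht => (hK ⟨t, ht, rfl⟩).trans (le_max_left _ _)⟩

theorem exists_norm_expm_mulVec_le {n : ℕ} (A : Matrix (Fin n) (Fin n) ℝ) (R : ℝ) :
    ∃ K : ℝ, 0 ≤ K ∧ ∀ t ∈ Set.Icc (-R) R, ∀ x : Fin n → ℝ,
      ‖(NormedSpace.exp (t • A)).mulVec x‖ ≤ K * ‖x‖ := by
  obtain ⟨K, hK, h⟩ := exists_norm_expm_le A R
  refine ⟨K, hK, fun t ht x => ?_⟩
  open scoped Matrix.Norms.Operator in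
  exact (Matrix.linfty_opNorm_mulVec _ x).trans
    (mul_le_mul_of_nonneg_right (h t ht) (norm_nonneg x))

theorem hasDerivAt_expm_mulVec {n : ℕ} (A : Matrix (Fin n) (Fin n) ℝ) (x : Fin n → ℝ) (t : ℝ) :
    HasDerivAt (fun t : ℝ => (NormedSpace.exp (t • A)).mulVec x)
      ((NormedSpace.exp (t • A)).mulVec (A.mulVec x)) t := by
  open scoped Matrix.Norms.Operator in
  have h := hasDerivAt_expm A t
  let L : Matrix (Fin n) (Fin n) ℝ →L[ℝ] (Fin n → ℝ) :=
    LinearMap.toContinuousLinearMap ((Matrix.mulVecBilin ℝ ℝ).flip x)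
  have := L.hasFDerivAt.comp_hasDerivAt t h
  rw [Matrix.mulVec_mulVec]
  exact this

namespace CTSystem

variable (G : CTSystem)

/-- The flow `e^{tA}` of the state equation. -/
noncomputable def flow (t : ℝ) : (Fin G.n → ℝ) →L[ℝ] (Fin G.n → ℝ) :=
  LinearMap.toContinuousLinearMap (Matrix.mulVecLin (NormedSpace.exp (t • G.A)))

theorem flow_apply (t : ℝ) (x : Fin G.n → ℝ) :
    G.flow t x = (NormedSpace.exp (t • G.A)).mulVec x := rfl

theorem flow_add (s t : ℝ) (x : Fin G.n → ℝ) : G.flow (s + t) x = G.flow s (G.flow t x) := by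
  rw [flow_apply, flow_apply, flow_apply, Matrix.mulVec_mulVec, add_smul,
    Matrix.exp_add_of_commute _ _ (((Commute.refl G.A).smul_left s).smul_right t)]

theorem flow_zero (x : Fin G.n → ℝ) : G.flow 0 x = x := by
  rw [flow_apply, zero_smul, NormedSpace.exp_zero, Matrix.one_mulVec]

theorem hasDerivAt_flow (x : Fin G.n → ℝ) (t : ℝ) :
    HasDerivAt (fun t => G.flow t x) (G.flow t (G.A.mulVec x)) t :=
  hasDerivAt_expm_mulVec G.A x t

theorem continuous_flow_apply (x : Fin G.n → ℝ) : Continuous fun t => G.flow t x :=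
  continuous_iff_continuousAt.2 fun t => (G.hasDerivAt_flow x t).continuousAt

theorem continuous_flow : Continuous fun p : ℝ × (Fin G.n → ℝ) => G.flow p.1 p.2 := by
  have h : (fun p : ℝ × (Fin G.n → ℝ) => G.flow p.1 p.2)
      = fun p => ∑ i, p.2 i • G.flow p.1 (Pi.single i 1) := by
    funext p
    conv_lhs => rw [pi_eq_sum_univ' p.2]
    simp [map_sum]
  rw [h]
  refine continuous_finsetSum _ fun i _ => ?_
  exact ((continuous_apply i).comp continuous_snd).smul
    ((G.continuous_flow_apply _).comp continuous_fst)

theorem exists_norm_flow_le (R : ℝ) : ∃ K : ℝ, 0 ≤ K ∧ ∀ t ∈ Set.Icc (-R) R,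
    ∀ x : Fin G.n → ℝ, ‖G.flow t x‖ ≤ K * ‖x‖ :=
  exists_norm_expm_mulVec_le G.A R

/-- The response of the state to a unit step. -/
noncomputable def stepState (t : ℝ) : Fin G.n → ℝ := ∫ r in (0 : ℝ)..t, G.flow r G.B

theorem hasDerivAt_stepState (t : ℝ) : HasDerivAt G.stepState (G.flow t G.B) t :=
  ((G.continuous_flow_apply G.B).integral_hasStrictDerivAt 0 t).hasDerivAt

/-- The output row as a functional. -/
noncomputable def out : (Fin G.n → ℝ) →L[ℝ] ℝ :=
  LinearMap.toContinuousLinearMap (dotProductBilin ℝ ℝ G.C)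

/-- The output at time `t` from the initial state `z.1` under the constant input `z.2`. -/
noncomputable def response (t : ℝ) (z : (Fin G.n → ℝ) × ℝ) : ℝ :=
  G.out (G.flow t z.1 + z.2 • G.stepState t) + G.D * z.2

/-- The state at time `t` transported back to time `0`. -/
noncomputable def pullState (u : ℝ → ℝ) (t : ℝ) : Fin G.n → ℝ :=
  ∫ s in (0 : ℝ)..t, u s • G.flow (-s) G.B

variable {G}

theorem intervalIntegrable_pull {u : ℝ → ℝ} {a b : ℝ} (hu : IntervalIntegrable u volume a b) :
    IntervalIntegrable (fun s => u s • G.flow (-s) G.B) volume a b :=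
  hu.smul_continuousOn ((G.continuous_flow_apply G.B).comp continuous_neg).continuousOn

/-- The semigroup law separates the kernel into a factor depending on `t` and one depending on `s`;
the integral left over is a primitive in `t`. -/
theorem io_eq {u : ℝ → ℝ} {t : ℝ} (hu : IntervalIntegrable u volume 0 t) :
    G.io u t = G.out (G.flow t (G.pullState u t)) + G.D * u t := by
  have h := (G.out ∘L G.flow t).intervalIntegral_comp_comm (intervalIntegrable_pull (G := G) hu)
  rw [pullState, ← ContinuousLinearMap.comp_apply, ← h, io]
  congr 1
  refine intervalIntegral.integral_congr fun s _ => ?_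
  simp only [ContinuousLinearMap.comp_apply, map_smul, ← flow_add, ← sub_eq_add_neg, smul_eq_mul]
  rw [mul_comm]
  rfl

end CTSystem

/-! ### Response to zero-order-hold inputs -/

theorem measurable_hold (τ : ℝ) (v : ℕ → ℝ) : Measurable (hold τ v) :=
  (measurable_from_nat (f := v)).comp (Nat.measurable_floor.comp (measurable_id.div_const τ))

theorem hold_eq {τ : ℝ} (hτ : 0 < τ) (v : ℕ → ℝ) (k : ℕ) {δ : ℝ} (h0 : 0 ≤ δ) (h1 : δ < τ) :
    hold τ v (k * τ + δ) = v k := by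
  have : ⌊(k * τ + δ) / τ⌋₊ = k := by
    rw [add_div, mul_div_cancel_right₀ _ hτ.ne', Nat.floor_eq_iff (by positivity)]
    exact ⟨by linarith [div_nonneg h0 hτ.le], by linarith [(div_lt_one hτ).2 h1]⟩
  rw [hold, this]

theorem intervalIntegrable_hold {τ : ℝ} (hτ : 0 < τ) (v : ℕ → ℝ) (a b : ℝ) :
    IntervalIntegrable (hold τ v) volume a b := by
  rw [intervalIntegrable_iff]
  refine Measure.integrableOn_of_bounded (M := ∑ k ∈ Finset.range (⌊max a b / τ⌋₊ + 1), |v k|)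
    (by simp [Set.uIoc]) (measurable_hold τ v).aestronglyMeasurable ?_
  refine (ae_restrict_iff' measurableSet_uIoc).2 (ae_of_all _ fun t ht => ?_)
  refine Finset.single_le_sum (f := fun k => |v k|) (fun _ _ => abs_nonneg _) ?_
  rw [Finset.mem_range, Nat.lt_succ_iff]
  exact Nat.floor_mono (by gcongr; exact ht.2)

namespace CTSystem

variable (G : CTSystem)

/-- The states at the sampling instants under a zero-order hold input. -/
noncomputable def holdState (τ : ℝ) (v : ℕ → ℝ) : ℕ → Fin G.n → ℝ
  | 0 => 0
  | k + 1 => G.flow τ (holdState τ v k) + v k • G.stepState τ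

variable {G}

theorem pullState_add_sub {u : ℝ → ℝ} {a b : ℝ} (h : ∀ a b, IntervalIntegrable u volume a b) :
    G.pullState u b = G.pullState u a + ∫ s in a..b, u s • G.flow (-s) G.B :=
  (intervalIntegral.integral_add_adjacent_intervals (intervalIntegrable_pull (h _ _))
    (intervalIntegrable_pull (h _ _))).symm

theorem flow_integral_hold {τ : ℝ} (hτ : 0 < τ) (v : ℕ → ℝ) (k : ℕ) {δ : ℝ} (h0 : 0 ≤ δ)
    (h1 : δ ≤ τ) : G.flow (k * τ + δ)
      (∫ s in (k * τ)..(k * τ + δ), hold τ v s • G.flow (-s) G.B) = v k • G.stepState δ := by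
  have e1 : ∫ s in (k * τ)..(k * τ + δ), hold τ v s • G.flow (-s) G.B
      = ∫ r in (0 : ℝ)..δ, v k • G.flow (-(k * τ + r)) G.B := by
    have := intervalIntegral.integral_comp_add_left (a := 0) (b := δ)
      (fun s => hold τ v s • G.flow (-s) G.B) (k * τ)
    rw [add_zero] at this
    rw [← this]
    refine intervalIntegral.integral_congr_Ioo_of_le h0 fun r hr => ?_
    simp only [hold_eq hτ v k hr.1.le (hr.2.trans_le h1)]
  have hc : Continuous fun r : ℝ => v k • G.flow (-(k * τ + r)) G.B :=
    ((G.continuous_flow_apply G.B).comp (by fun_prop : Continuous fun r : ℝ => -(k * τ + r))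
      ).const_smul (v k)
  rw [e1, ← ContinuousLinearMap.intervalIntegral_comp_comm _ (hc.intervalIntegrable _ _)]
  simp only [map_smul, ← flow_add, intervalIntegral.integral_smul, stepState]
  congr 1
  have := intervalIntegral.integral_comp_sub_left (a := 0) (b := δ) (fun r => G.flow r G.B) δ
  rw [sub_self, sub_zero] at this
  rw [← this]
  refine intervalIntegral.integral_congr fun r _ => ?_
  congr 2
  ring

theorem flow_pullState_hold {τ : ℝ} (hτ : 0 < τ) (v : ℕ → ℝ) (k : ℕ) {δ : ℝ} (h0 : 0 ≤ δ)
    (h1 : δ ≤ τ) : G.flow (k * τ + δ) (G.pullState (hold τ v) (k * τ + δ))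
      = G.flow δ (G.holdState τ v k) + v k • G.stepState δ := by
  -- The formula inside a period follows from its case `δ = 0`; the end point `δ = τ` then supplies
  -- the case `δ = 0` of the next period.
  have key : G.flow (k * τ) (G.pullState (hold τ v) (k * τ)) = G.holdState τ v k →
      ∀ δ, 0 ≤ δ → δ ≤ τ → G.flow (k * τ + δ) (G.pullState (hold τ v) (k * τ + δ))
      = G.flow δ (G.holdState τ v k) + v k • G.stepState δ := by
    intro hk δ h0 h1
    rw [pullState_add_sub (a := k * τ) (intervalIntegrable_hold hτ v), map_add,
      flow_integral_hold hτ v k h0 h1, add_comm (k * τ) δ, flow_add, hk]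
  refine key ?_ δ h0 h1
  clear h0 h1 δ key
  induction k with
  | zero => simp [pullState, holdState]
  | succ k ih =>
    have e : ((k + 1 : ℕ) : ℝ) * τ = k * τ + τ := by push_cast; ring
    rw [e, holdState, pullState_add_sub (a := k * τ) (intervalIntegrable_hold hτ v), map_add,
      flow_integral_hold hτ v k hτ.le le_rfl, add_comm (k * τ) τ, flow_add, ih]

theorem io_hold {τ : ℝ} (hτ : 0 < τ) (v : ℕ → ℝ) (k : ℕ) {δ : ℝ} (h0 : 0 ≤ δ) (h1 : δ < τ) :
    G.io (hold τ v) (k * τ + δ) = G.response δ (G.holdState τ v k, v k) := by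
  rw [io_eq (intervalIntegrable_hold hτ v _ _), flow_pullState_hold hτ v k h0 h1.le,
    hold_eq hτ v k h0 h1, response]

theorem io_hold_mul {τ : ℝ} (hτ : 0 < τ) (v : ℕ → ℝ) (k : ℕ) :
    G.io (hold τ v) (k * τ) = G.out (G.holdState τ v k) + G.D * v k := by
  have := io_hold (G := G) hτ v k le_rfl hτ
  rw [add_zero] at this
  rw [this, response]
  simp [stepState, flow_zero]

end CTSystem

/-! ### Finite-dimensional realization of the discretizations -/

theorem Realizable.sampler_io_hold (G : CTSystem) {τ : ℝ} (hτ : 0 < τ) :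
    Realizable fun v => sampler τ (G.io (hold τ v)) := by
  refine ⟨Fin G.n → ℝ, inferInstance, inferInstance, inferInstance, (G.flow τ).toLinearMap,
    LinearMap.toSpanSingleton ℝ _ (G.stepState τ), G.out.toLinearMap,
    LinearMap.toSpanSingleton ℝ _ G.D, fun v => ⟨G.holdState τ v, rfl, fun k => ?_, fun k => ?_⟩⟩
  · rfl
  · simp only [sampler]
    rw [CTSystem.io_hold_mul hτ]
    simp [mul_comm]

theorem Realizable.fsfh_io (G : CTSystem) {h : ℝ} (hh : 0 < h) {N : ℕ} (hN : 0 < N) :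
    Realizable (fsfh h N G.io) :=
  (Realizable.sampler_io_hold G (by positivity : 0 < h / N)).lift hN

theorem Realizable.decimDiscretization (F P : CTSystem) (H₀ : DTSystem 1 1) {q M l : ℕ} (m : ℕ)
    {h : ℝ} (hh : 0 < h) (hq : q < M) (hl : 0 < l) :
    Realizable (decimDiscretization F P (_root_.filterOp H₀ q) M l m h) := by
  have hN : 0 < M * l := Nat.mul_pos (Nat.zero_lt_of_lt hq) hl
  have hF := Realizable.fsfh_io F hh hN
  have hhold := Realizable.static
    (Matrix.mulVecLin (holdMatrix (M * l)) ∘ₗ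
      (LinearMap.pi fun _ => LinearMap.id : ℝ →ₗ[ℝ] (Fin 1 → ℝ)))
  have hS := Realizable.static (Matrix.mulVecLin (samplingMatrix M l))
  exact ((Realizable.dtDelay _ m).comp hF).sub ((Realizable.fsfh_io P hh hN).comp
    (hhold.comp ((Realizable.liftedFilter H₀ hq).comp (hS.comp hF))))

/-! ### Exponential decay of a stable flow -/

theorem Matrix.pow_mulVec_of_eigenvector {n : ℕ} {A : Matrix (Fin n) (Fin n) ℂ} {v : Fin n → ℂ}
    {μ : ℂ} (hv : A.mulVec v = μ • v) (k : ℕ) : (A ^ k).mulVec v = μ ^ k • v := by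
  induction k with
  | zero => simp
  | succ k ih => rw [pow_succ, ← Matrix.mulVec_mulVec, hv, Matrix.mulVec_smul, ih, smul_smul,
      pow_succ']

open scoped Matrix.Norms.Operator in
theorem Matrix.exp_mulVec_of_eigenvector {n : ℕ} {A : Matrix (Fin n) (Fin n) ℂ} {v : Fin n → ℂ}
    {μ : ℂ} (hv : A.mulVec v = μ • v) :
    (NormedSpace.exp A).mulVec v = Complex.exp μ • v := by
  have h := NormedSpace.exp_series_hasSum_exp' (𝕂 := ℂ) A
  let L : Matrix (Fin n) (Fin n) ℂ →L[ℂ] (Fin n → ℂ) :=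
    LinearMap.toContinuousLinearMap ((Matrix.mulVecBilin ℂ ℂ).flip v)
  have h1 := h.mapL L
  have h2 := NormedSpace.exp_series_hasSum_exp' (𝕂 := ℂ) μ
  have h3 := h2.smul_const v
  have h4 : (fun k : ℕ => L (((k.factorial : ℂ))⁻¹ • A ^ k))
      = fun k : ℕ => (((k.factorial : ℂ))⁻¹ • μ ^ k) • v := by
    funext k
    rw [map_smul, smul_assoc, ← Matrix.pow_mulVec_of_eigenvector hv]
    rfl
  rw [h4] at h1
  rw [Complex.exp_eq_exp_ℂ]
  exact h1.unique h3

open scoped Matrix.Norms.Operator in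
/-- The spectrum of the exponential of a matrix consists of exponentials of eigenvalues. -/
theorem Matrix.exists_exp_eq_of_mem_spectrum_exp {n : ℕ} (A : Matrix (Fin n) (Fin n) ℂ) {z : ℂ}
    (hz : z ∈ spectrum ℂ (NormedSpace.exp A)) : ∃ μ ∈ spectrum ℂ A, z = Complex.exp μ := by
  rcases subsingleton_or_nontrivial (Matrix (Fin n) (Fin n) ℂ) with hn | hn
  · rw [spectrum.of_subsingleton] at hz
    exact hz.elim
  -- The algebra generated by `A` is finite-dimensional, hence closed, so `exp A` is a polynomial in
  -- `A`. Polynomial spectral mapping gives `z = p(μ)`, and an eigenvector for `μ` identifies `p(μ)`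
  -- with `exp μ`.
  have hcl : IsClosed (Algebra.adjoin ℂ {A} : Set (Matrix (Fin n) (Fin n) ℂ)) :=
    Submodule.closed_of_finiteDimensional (Subalgebra.toSubmodule (Algebra.adjoin ℂ {A}))
  have hmem : NormedSpace.exp A ∈ Algebra.adjoin ℂ {A} :=
    NormedSpace.exp_mem (R := ℂ) hcl (Algebra.subset_adjoin rfl)
  rw [Algebra.adjoin_singleton_eq_range_aeval] at hmem
  obtain ⟨p, hp⟩ := hmem
  have hp : Polynomial.aeval A p = NormedSpace.exp A := hp
  rw [← hp, spectrum.map_polynomial_aeval] at hz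
  obtain ⟨μ, hμ, rfl⟩ := hz
  refine ⟨μ, hμ, ?_⟩
  rw [← Matrix.spectrum_toLin', ← Module.End.hasEigenvalue_iff_mem_spectrum] at hμ
  obtain ⟨v, hv⟩ := hμ.exists_hasEigenvector
  have hAv : A.mulVec v = μ • v := by
    have := hv.apply_eq_smul
    rwa [Matrix.toLin'_apply] at this
  have h1 := Module.End.aeval_apply_of_hasEigenvector (p := p) hv
  have h2 : (Polynomial.aeval (Matrix.toLin' A)) p = Matrix.toLin' (NormedSpace.exp A) := by
    rw [← hp]
    exact Polynomial.aeval_algHom_apply (Matrix.toLinAlgEquiv' (R := ℂ) (n := Fin n)).toAlgHom A p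
  rw [h2, Matrix.toLin'_apply, Matrix.exp_mulVec_of_eigenvector hAv] at h1
  exact (smul_left_injective ℂ hv.2 h1).symm

-- The spectrum of `exp A` lies in the open unit disc, so Gelfand's formula makes some power a
-- contraction.
open scoped Matrix.Norms.Operator in
theorem Matrix.exists_norm_exp_pow_lt_one {n : ℕ} (A : Matrix (Fin n) (Fin n) ℂ)
    (hA : ∀ μ ∈ spectrum ℂ A, μ.re < 0) : ∃ k : ℕ, 0 < k ∧ ‖NormedSpace.exp A ^ k‖ < 1 := by
  rcases subsingleton_or_nontrivial (Matrix (Fin n) (Fin n) ℂ) with hn | hn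
  · exact ⟨1, one_pos, by rw [Subsingleton.elim (NormedSpace.exp A ^ 1) 0]; simp⟩
  have h1 : spectralRadius ℂ (NormedSpace.exp A) < 1 := by
    refine spectrum.spectralRadius_lt_of_forall_lt (r := 1) _ fun z hz => ?_
    obtain ⟨μ, hμ, rfl⟩ := A.exists_exp_eq_of_mem_spectrum_exp hz
    rw [← NNReal.coe_lt_coe, coe_nnnorm, Complex.norm_exp]
    simpa using hA μ hμ
  have h2 := (spectrum.pow_nnnorm_pow_one_div_tendsto_nhds_spectralRadius
    (NormedSpace.exp A)).eventually (gt_mem_nhds h1)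
  obtain ⟨k, hk, hk0⟩ := (h2.and (eventually_gt_atTop 0)).exists
  refine ⟨k, hk0, ?_⟩
  by_contra! hc
  have : (1 : ℝ≥0∞) ≤ ‖NormedSpace.exp A ^ k‖₊ := by
    rw [← ENNReal.coe_one, ENNReal.coe_le_coe, ← NNReal.coe_le_coe]
    simpa using hc
  exact absurd hk (not_lt.2 (ENNReal.one_le_rpow this (by positivity)))

open scoped Matrix.Norms.Operator in
theorem Matrix.map_exp_algebraMap {n : ℕ} (A : Matrix (Fin n) (Fin n) ℝ) :
    (NormedSpace.exp A).map (algebraMap ℝ ℂ) = NormedSpace.exp (A.map (algebraMap ℝ ℂ)) := by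
  refine NormedSpace.map_exp (algebraMap ℝ ℂ).mapMatrix ?_ A
  exact (Continuous.matrix_map continuous_id Complex.continuous_ofReal :)

theorem exists_norm_expm_mulVec_le_mul {n : ℕ} (A : Matrix (Fin n) (Fin n) ℝ)
    (hA : ∀ μ ∈ spectrum ℂ (A.map (algebraMap ℝ ℂ)), μ.re < 0) :
    ∃ (k : ℕ) (θ : ℝ), 0 < k ∧ 0 < θ ∧ θ < 1 ∧
      ∀ x : Fin n → ℝ, ‖(NormedSpace.exp ((k : ℝ) • A)).mulVec x‖ ≤ θ * ‖x‖ := by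
  open scoped Matrix.Norms.Operator in
  obtain ⟨k, hk, h1⟩ := Matrix.exists_norm_exp_pow_lt_one _ hA
  -- The maximum with `0` keeps `θ` positive, so that its logarithm can serve as decay rate.
  obtain ⟨θ, h2, h3⟩ := exists_between (max_lt h1 one_pos)
  refine ⟨k, θ, hk, (le_max_right _ _).trans_lt h2, h3, fun x => ?_⟩
  have hn : ∀ y : Fin n → ℝ, ‖fun i => (algebraMap ℝ ℂ) (y i)‖ = ‖y‖ := by
    intro y
    simp [Pi.norm_def]
  rw [Nat.cast_smul_eq_nsmul, Matrix.exp_nsmul, ← hn, ← hn x]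
  have h4 : (fun i => (algebraMap ℝ ℂ) ((NormedSpace.exp A ^ k).mulVec x i))
      = (NormedSpace.exp (A.map (algebraMap ℝ ℂ)) ^ k).mulVec (fun i => (algebraMap ℝ ℂ) (x i)) := by
    funext i
    rw [← Matrix.map_exp_algebraMap, ← RingHom.mapMatrix_apply, ← map_pow, RingHom.mapMatrix_apply]
    exact RingHom.map_mulVec _ _ _ _
  rw [h4]
  open scoped Matrix.Norms.Operator in
  exact (Matrix.linfty_opNorm_mulVec _ _).trans
    (mul_le_mul_of_nonneg_right ((le_max_left _ _).trans h2.le) (norm_nonneg _))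

namespace CTSystem

theorem IsStable.exists_flow_decay {G : CTSystem} (hG : G.IsStable) :
    ∃ K α : ℝ, 0 ≤ K ∧ 0 < α ∧ ∀ t, 0 ≤ t → ∀ x, ‖G.flow t x‖ ≤ K * Real.exp (-α * t) * ‖x‖ := by
  obtain ⟨T, θ, hT, h0, h1, hθ⟩ := exists_norm_expm_mulVec_le_mul G.A hG
  obtain ⟨K, hK, hb⟩ := G.exists_norm_flow_le T
  have hT' : (0 : ℝ) < T := by exact_mod_cast hT
  have hpow : ∀ (j : ℕ) x, ‖G.flow (j * T) x‖ ≤ θ ^ j * ‖x‖ := by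
    intro j
    induction j with
    | zero => intro x; simp [flow_zero]
    | succ j ih =>
      intro x
      have : ((j + 1 : ℕ) : ℝ) * T = T + j * T := by push_cast; ring
      rw [this, flow_add, pow_succ', mul_assoc]
      exact (hθ _).trans (mul_le_mul_of_nonneg_left (ih x) h0.le)
  have hlog : Real.log θ < 0 := Real.log_neg h0 h1
  -- The flow contracts by `θ` over each time `T` and is bounded by `K` on the remainder. Replacing
  -- `⌊t / T⌋` by `t / T` in the exponent costs at most one factor `1 / θ`.
  refine ⟨K * Real.exp (-Real.log θ), -Real.log θ / T, by positivity,
    div_pos (neg_pos.2 hlog) hT', fun t ht x => ?_⟩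
  set j := ⌊t / T⌋₊ with hj
  have hj1 : (j : ℝ) * T ≤ t := by
    rw [← le_div_iff₀ hT']; exact Nat.floor_le (by positivity)
  have hj2 : t < (j + 1) * T := by
    rw [← div_lt_iff₀ hT']; exact Nat.lt_floor_add_one _
  have h2 : θ ^ j ≤ Real.exp (-Real.log θ) * Real.exp (-(-Real.log θ / T) * t) := by
    rw [← Real.exp_add, ← Real.exp_log h0, ← Real.exp_nat_mul, Real.exp_le_exp, Real.exp_log h0]
    have h3 : t / T ≤ j + 1 := by rw [div_le_iff₀ hT']; exact hj2.le
    have : -(-Real.log θ / T) * t = Real.log θ * (t / T) := by ring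
    rw [this]
    nlinarith
  calc ‖G.flow t x‖ = ‖G.flow (t - j * T) (G.flow (j * T) x)‖ := by rw [← flow_add]; simp
    _ ≤ K * ‖G.flow (j * T) x‖ := hb _ ⟨by linarith, by linarith⟩ _
    _ ≤ K * (θ ^ j * ‖x‖) := by gcongr; exact hpow j x
    _ ≤ K * ((Real.exp (-Real.log θ) * Real.exp (-(-Real.log θ / T) * t)) * ‖x‖) := by gcongr
    _ = _ := by ring

end CTSystem

/-! ### Norms of hold signals and gains of discretizations -/

theorem L2Norm_sq (w : ℝ → ℝ) : L2Norm w ^ 2 = ∫⁻ t in Set.Ici 0, ‖w t‖ₑ ^ 2 := by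
  rw [L2Norm, eLpNorm_eq_lintegral_rpow_enorm_toReal (by norm_num) (by norm_num),
    ← ENNReal.rpow_natCast, ← ENNReal.rpow_mul]
  norm_num

theorem l2Norm_sq {p : ℕ} (v : ℕ → Fin p → ℝ) : l2Norm v ^ 2 = ∑' k, ∑ i, ‖v k i‖ₑ ^ 2 := by
  rw [l2Norm, ← ENNReal.rpow_natCast, ← ENNReal.rpow_mul]
  norm_num

theorem sq_le_sq_ennreal {a b : ℝ≥0∞} : a ^ 2 ≤ b ^ 2 ↔ a ≤ b :=
  ENNReal.pow_le_pow_left_iff two_ne_zero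

theorem sq_eq_sq_ennreal {a b : ℝ≥0∞} : a ^ 2 = b ^ 2 ↔ a = b :=
  ⟨fun h => le_antisymm (sq_le_sq_ennreal.1 h.le) (sq_le_sq_ennreal.1 h.ge), fun h => h ▸ rfl⟩

/-- Integrals over `[0, ∞)` are sums of integrals over blocks. -/
theorem lintegral_Ici_eq_tsum {τ : ℝ} (hτ : 0 < τ) (f : ℝ → ℝ≥0∞) :
    ∫⁻ t in Set.Ici 0, f t = ∑' k : ℕ, ∫⁻ δ in Set.Ico 0 τ, f (k * τ + δ) := by
  have hU : Set.Ici (0 : ℝ) = ⋃ k : ℕ, Set.Ico (k * τ) (k * τ + τ) := by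
    ext t
    simp only [Set.mem_Ici, Set.mem_iUnion, Set.mem_Ico]
    constructor
    · intro ht
      refine ⟨⌊t / τ⌋₊, ?_, ?_⟩
      · rw [← le_div_iff₀ hτ]; exact Nat.floor_le (by positivity)
      · have := Nat.lt_floor_add_one (t / τ)
        rw [div_lt_iff₀ hτ] at this
        linarith
    · rintro ⟨k, h1, _⟩
      exact le_trans (by positivity) h1
  have hd : Pairwise (Function.onFun Disjoint fun k : ℕ => Set.Ico (k * τ) (k * τ + τ)) := by
    have key : ∀ i j : ℕ, i < j → Disjoint (Set.Ico (i * τ) (i * τ + τ))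
        (Set.Ico (j * τ) (j * τ + τ)) := by
      intro i j hij
      rw [Set.disjoint_left]
      rintro t ⟨_, h1⟩ ⟨h2, _⟩
      have : ((i : ℝ) + 1) ≤ j := by exact_mod_cast hij
      nlinarith
    intro i j hij
    rcases lt_or_gt_of_ne hij with h | h
    · exact key i j h
    · exact (key j i h).symm
  rw [hU, lintegral_iUnion (fun _ => measurableSet_Ico) hd]
  refine tsum_congr fun k => ?_
  have hmp := measurePreserving_add_left (volume : Measure ℝ) (k * τ)
  have := hmp.setLIntegral_comp_preimage_emb (measurableEmbedding_addLeft (k * τ)) f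
    (Set.Ico (k * τ) (k * τ + τ))
  rw [← this]
  simp

theorem L2Norm_hold_sq {τ : ℝ} (hτ : 0 < τ) (x : ℕ → ℝ) :
    L2Norm (hold τ x) ^ 2 = ENNReal.ofReal τ * ∑' k, ‖x k‖ₑ ^ 2 := by
  rw [L2Norm_sq, lintegral_Ici_eq_tsum hτ, ← ENNReal.tsum_mul_left]
  refine tsum_congr fun k => ?_
  rw [setLIntegral_congr_fun (g := fun _ => ‖x k‖ₑ ^ 2) measurableSet_Ico]
  · rw [setLIntegral_const, Real.volume_Ico, sub_zero, mul_comm]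
  · intro δ hδ
    simp only [hold_eq hτ x k hδ.1 hδ.2]

theorem tsum_dliftInv {N : ℕ} (hN : 0 < N) (v : ℕ → Fin N → ℝ) :
    ∑' n, ‖dliftInv N v n‖ₑ ^ 2 = ∑' k, ∑ i, ‖v k i‖ₑ ^ 2 := by
  have : NeZero N := ⟨hN.ne'⟩
  rw [← (Nat.divModEquiv N).symm.tsum_eq, ENNReal.tsum_prod
    (f := fun k i => ‖dliftInv N v ((Nat.divModEquiv N).symm (k, i))‖ₑ ^ 2)]
  refine tsum_congr fun k => ?_
  rw [tsum_fintype]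
  refine Finset.sum_congr rfl fun i _ => ?_
  have := congrFun (congrFun (dlift_dliftInv hN v) k) i
  rw [← this, dlift]
  simp [Nat.divModEquiv]

/-- The piecewise constant interpolation of a signal. -/
noncomputable def interp (τ : ℝ) (g : ℝ → ℝ) : ℝ → ℝ := hold τ (sampler τ g)

theorem interp_apply (τ : ℝ) (g : ℝ → ℝ) (t : ℝ) : interp τ g t = g (⌊t / τ⌋₊ * τ) := rfl

theorem L2Norm_hold_dliftInv {h : ℝ} (hh : 0 < h) {N : ℕ} (hN : 0 < N) (v : ℕ → Fin N → ℝ) :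
    L2Norm (hold (h / N) (dliftInv N v)) = ENNReal.ofReal (h / N) ^ (1 / 2 : ℝ) * l2Norm v := by
  have hτ : 0 < h / N := by positivity
  refine sq_eq_sq_ennreal.1 ?_
  rw [L2Norm_hold_sq hτ, tsum_dliftInv hN, mul_pow, l2Norm_sq, ← ENNReal.rpow_natCast,
    ← ENNReal.rpow_mul]
  norm_num

theorem ofReal_rpow_half_ne_zero {τ : ℝ} (hτ : 0 < τ) : ENNReal.ofReal τ ^ (1 / 2 : ℝ) ≠ 0 := by
  simp [hτ]

theorem ofReal_rpow_half_ne_top (τ : ℝ) : ENNReal.ofReal τ ^ (1 / 2 : ℝ) ≠ ∞ := by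
  simp

/-- The factor is the one relating the norm of `v` to that of its hold, so it cancels in the
quotient defining the gain. -/
theorem l2Norm_fsfh {h : ℝ} (hh : 0 < h) {N : ℕ} (hN : 0 < N) (T : (ℝ → ℝ) → ℝ → ℝ)
    (v : ℕ → Fin N → ℝ) :
    ENNReal.ofReal (h / N) ^ (1 / 2 : ℝ) * l2Norm (fsfh h N T v)
      = L2Norm (interp (h / N) (T (hold (h / N) (dliftInv N v)))) := by
  rw [← L2Norm_hold_dliftInv hh hN, fsfh, dliftInv_dlift hN, interp]

theorem inducedNorml2_fsfh_le {h : ℝ} (hh : 0 < h) {N : ℕ} (hN : 0 < N) (T : (ℝ → ℝ) → ℝ → ℝ)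
    {c : ℝ≥0∞} (hc : ∀ x : ℕ → ℝ, L2Norm (hold (h / N) x) ≠ ∞ → L2Norm (hold (h / N) x) ≠ 0 →
      L2Norm (interp (h / N) (T (hold (h / N) x))) ≤ c * L2Norm (hold (h / N) x)) :
    inducedNorml2 (fsfh h N T) ≤ c := by
  have hτ : 0 < h / N := by positivity
  refine iSup_le fun v => iSup_le fun h1 => iSup_le fun h0 => ?_
  rw [ENNReal.div_le_iff h0 h1]
  have := hc (dliftInv N v) ?_ ?_
  · rw [← l2Norm_fsfh hh hN, L2Norm_hold_dliftInv hh hN, mul_left_comm] at this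
    exact (ENNReal.mul_le_mul_iff_right (ofReal_rpow_half_ne_zero hτ)
      (ofReal_rpow_half_ne_top _)).1 this
  · rw [L2Norm_hold_dliftInv hh hN]
    exact ENNReal.mul_ne_top (ofReal_rpow_half_ne_top _) h1
  · rw [L2Norm_hold_dliftInv hh hN]
    exact mul_ne_zero (ofReal_rpow_half_ne_zero hτ) h0

theorem L2Norm_interp_le {h : ℝ} (hh : 0 < h) {N : ℕ} (hN : 0 < N) (T : (ℝ → ℝ) → ℝ → ℝ)
    (x : ℕ → ℝ) (h1 : L2Norm (hold (h / N) x) ≠ ∞) (h0 : L2Norm (hold (h / N) x) ≠ 0) :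
    L2Norm (interp (h / N) (T (hold (h / N) x)))
      ≤ inducedNorml2 (fsfh h N T) * L2Norm (hold (h / N) x) := by
  have hτ : 0 < h / N := by positivity
  have e : dliftInv N (dlift N x) = x := dliftInv_dlift hN x
  have h2 := l2Norm_fsfh hh hN T (dlift N x)
  have h3 := L2Norm_hold_dliftInv hh hN (dlift N x)
  rw [e] at h2 h3
  rw [h3] at h1 h0
  have h4 : l2Norm (dlift N x) ≠ 0 := right_ne_zero_of_mul h0
  have h5 : l2Norm (dlift N x) ≠ ∞ := fun h => h1 (by
    rw [h, ENNReal.mul_top (ofReal_rpow_half_ne_zero hτ)])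
  rw [← h2, h3, mul_left_comm]
  gcongr
  rw [← ENNReal.div_le_iff h4 h5]
  exact le_iSup_of_le (dlift N x) (le_iSup_of_le h5 (le_iSup_of_le h4 le_rfl))

/-- A signal dominated blockwise by a sequence is dominated in norm. -/
theorem L2Norm_le_of_block {τ : ℝ} (hτ : 0 < τ) {g : ℝ → ℝ} {c : ℕ → ℝ}
    (hg : ∀ (k : ℕ) δ, 0 ≤ δ → δ < τ → |g (k * τ + δ)| ≤ c k) :
    L2Norm g ^ 2 ≤ ENNReal.ofReal τ * ∑' k, ‖c k‖ₑ ^ 2 := by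
  rw [← L2Norm_hold_sq hτ, L2Norm_sq, L2Norm_sq, lintegral_Ici_eq_tsum hτ, lintegral_Ici_eq_tsum hτ]
  refine ENNReal.tsum_le_tsum fun k => setLIntegral_mono' measurableSet_Ico fun δ hδ => ?_
  rw [hold_eq hτ c k hδ.1 hδ.2]
  gcongr
  rw [Real.enorm_eq_ofReal_abs, Real.enorm_eq_ofReal_abs]
  exact ENNReal.ofReal_le_ofReal ((hg k δ hδ.1 hδ.2).trans (le_abs_self _))

theorem interp_eq {τ : ℝ} (hτ : 0 < τ) (g : ℝ → ℝ) (k : ℕ) {δ : ℝ} (h0 : 0 ≤ δ) (h1 : δ < τ) :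
    interp τ g (k * τ + δ) = g (k * τ) := by
  rw [interp, hold_eq hτ _ k h0 h1, sampler]

theorem tsum_enorm_sq_le {a b : ℕ → ℝ} {C : ℝ} (hC : 0 ≤ C)
    (h : ∀ n, ∑ k ∈ Finset.range n, a k ^ 2 ≤ C * ∑ k ∈ Finset.range n, b k ^ 2) :
    ∑' k, ‖a k‖ₑ ^ 2 ≤ ENNReal.ofReal C * ∑' k, ‖b k‖ₑ ^ 2 := by
  have e : ∀ x : ℝ, ‖x‖ₑ ^ 2 = ENNReal.ofReal (x ^ 2) := by
    intro x
    rw [Real.enorm_eq_ofReal_abs, ← ENNReal.ofReal_pow (abs_nonneg x), sq_abs]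
  rw [ENNReal.tsum_eq_iSup_nat]
  refine iSup_le fun n => ?_
  calc ∑ k ∈ Finset.range n, ‖a k‖ₑ ^ 2
      = ENNReal.ofReal (∑ k ∈ Finset.range n, a k ^ 2) := by
        rw [ENNReal.ofReal_sum_of_nonneg fun _ _ => sq_nonneg _]
        simp only [e]
    _ ≤ ENNReal.ofReal (C * ∑ k ∈ Finset.range n, b k ^ 2) := ENNReal.ofReal_le_ofReal (h n)
    _ = ENNReal.ofReal C * ∑ k ∈ Finset.range n, ‖b k‖ₑ ^ 2 := by
        rw [ENNReal.ofReal_mul hC, ENNReal.ofReal_sum_of_nonneg fun _ _ => sq_nonneg _]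
        simp only [e]
    _ ≤ _ := by gcongr; exact ENNReal.sum_le_tsum _

/-- The energy of the exponentially weighted sums of a sequence. -/
theorem sum_sq_le_of_recursion {ρ : ℝ} (h0 : 0 ≤ ρ) (h1 : ρ < 1) {a b : ℕ → ℝ} (ha0 : a 0 = 0)
    (ha : ∀ k, a (k + 1) = ρ * a k + b k) (n : ℕ) :
    ∑ k ∈ Finset.range n, a k ^ 2 ≤ (1 / (1 - ρ)) ^ 2 * ∑ k ∈ Finset.range n, b k ^ 2 := by
  have hr : 0 < 1 - ρ := by linarith
  -- The added term is a storage function: with it, `key` is a dissipation identity that carries the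
  -- induction step.
  suffices h : ∑ k ∈ Finset.range n, a k ^ 2 + a n ^ 2 / (1 - ρ)
      ≤ (1 / (1 - ρ)) ^ 2 * ∑ k ∈ Finset.range n, b k ^ 2 by
    have : 0 ≤ a n ^ 2 / (1 - ρ) := by positivity
    linarith
  induction n with
  | zero => simp [ha0]
  | succ n ih =>
    rw [Finset.sum_range_succ, Finset.sum_range_succ, ha, mul_add]
    have key : (ρ * a n + b n) ^ 2 / (1 - ρ) = a n ^ 2 / (1 - ρ) - a n ^ 2
        + (1 / (1 - ρ)) ^ 2 * b n ^ 2 - ρ * (a n - b n / (1 - ρ)) ^ 2 := by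
      field_simp
      ring
    have : 0 ≤ ρ * (a n - b n / (1 - ρ)) ^ 2 := by positivity
    linarith

/-! ### Energy and interpolation estimates under hold inputs -/

namespace CTSystem

variable {G : CTSystem}

theorem continuous_stepState (G : CTSystem) : Continuous G.stepState :=
  continuous_iff_continuousAt.2 fun t => (G.hasDerivAt_stepState t).continuousAt

/-- Energy bound for the sampled states of a stable system, uniform in the sampling period. -/
theorem IsStable.exists_sum_holdState_le (hG : G.IsStable) (h : ℝ) :
    ∃ C : ℝ, 0 ≤ C ∧ ∀ τ, 0 < τ → τ ≤ h → ∀ (v : ℕ → ℝ) (n : ℕ),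
      ∑ k ∈ Finset.range n, ‖G.holdState τ v k‖ ^ 2 ≤ C * ∑ k ∈ Finset.range n, v k ^ 2 := by
  obtain ⟨K, α, hK, hα, hdec⟩ := hG.exists_flow_decay
  have hexp : ∀ t, 0 ≤ t → Real.exp (-α * t) ≤ 1 := fun t ht =>
    Real.exp_le_one_iff.2 (by nlinarith)
  have hstep : ∀ τ, 0 ≤ τ → ‖G.stepState τ‖ ≤ K * ‖G.B‖ * τ := by
    intro τ hτ
    have := intervalIntegral.norm_integral_le_of_norm_le_const (a := 0) (b := τ)
      (f := fun r => G.flow r G.B) (C := K * ‖G.B‖) (fun r hr => ?_)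
    · rwa [sub_zero, abs_of_nonneg hτ] at this
    · rw [Set.uIoc_of_le hτ] at hr
      refine (hdec r hr.1.le _).trans ?_
      gcongr
      exact mul_le_of_le_one_right hK (hexp r hr.1.le)
  -- One input sample moves the state by `O(τ)`, while summing the decay costs `1 / (1 - ρ)`, of
  -- order `1 / τ`; the product is bounded by `(1 + α * h) / α` for all `τ ≤ h`.
  refine ⟨(K * (K * ‖G.B‖) * ((1 + α * h) / α)) ^ 2, by positivity, fun τ hτ hτh v n => ?_⟩
  set ρ := Real.exp (-α * τ) with hρ
  let a : ℕ → ℝ := fun k => Nat.rec 0 (fun k a => ρ * a + |v k|) k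
  have ha0 : a 0 = 0 := rfl
  have ha : ∀ k, a (k + 1) = ρ * a k + |v k| := fun k => rfl
  -- Flowing the state for an arbitrary further time `t` avoids picking up a factor `K` at every
  -- induction step.
  have hx : ∀ k t, 0 ≤ t →
      ‖G.flow t (G.holdState τ v k)‖ ≤ K * (K * ‖G.B‖) * τ * Real.exp (-α * t) * a k := by
    intro k
    induction k with
    | zero => intro t _; simp [holdState, ha0]
    | succ k ih =>
      intro t ht
      rw [holdState, map_add, ← flow_add, map_smul, ha]
      have e1 := ih (t + τ) (by positivity)
      have e2 : ‖v k • G.flow t (G.stepState τ)‖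
          ≤ |v k| * (K * Real.exp (-α * t) * (K * ‖G.B‖ * τ)) := by
        rw [norm_smul, Real.norm_eq_abs]
        gcongr
        exact (hdec t ht _).trans (by gcongr; exact hstep τ hτ.le)
      have e3 : Real.exp (-α * (t + τ)) = Real.exp (-α * t) * ρ := by
        rw [hρ, ← Real.exp_add]; ring_nf
      rw [e3] at e1
      refine (norm_add_le _ _).trans ((add_le_add e1 e2).trans_eq ?_)
      ring
  have hρ1 : ρ < 1 := by
    rw [hρ, Real.exp_lt_one_iff]
    nlinarith
  have hρ0 : 0 ≤ ρ := (Real.exp_pos _).le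
  have hr : 0 < 1 - ρ := by linarith
  have hτρ : τ * (1 / (1 - ρ)) ≤ (1 + α * h) / α := by
    have h1 : ρ * (1 + α * τ) ≤ 1 := by
      have h2 : 1 + α * τ ≤ Real.exp (α * τ) := by linarith [Real.add_one_le_exp (α * τ)]
      calc ρ * (1 + α * τ) ≤ ρ * Real.exp (α * τ) := by gcongr
        _ = 1 := by rw [hρ, ← Real.exp_add]; simp
    rw [mul_one_div, div_le_div_iff₀ hr hα]
    nlinarith [mul_nonneg (mul_nonneg hα.le (sub_nonneg.2 hτh)) hr.le]
  have hsum := sum_sq_le_of_recursion hρ0 hρ1 ha0 ha n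
  calc ∑ k ∈ Finset.range n, ‖G.holdState τ v k‖ ^ 2
      ≤ ∑ k ∈ Finset.range n, (K * (K * ‖G.B‖) * τ) ^ 2 * a k ^ 2 := by
        refine Finset.sum_le_sum fun k _ => ?_
        have := hx k 0 le_rfl
        rw [flow_zero, mul_zero, Real.exp_zero, mul_one] at this
        rw [← mul_pow]
        gcongr
    _ = (K * (K * ‖G.B‖) * τ) ^ 2 * ∑ k ∈ Finset.range n, a k ^ 2 := by rw [Finset.mul_sum]
    _ ≤ (K * (K * ‖G.B‖) * τ) ^ 2 *
        ((1 / (1 - ρ)) ^ 2 * ∑ k ∈ Finset.range n, |v k| ^ 2) := by gcongr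
    _ = (K * (K * ‖G.B‖) * (τ * (1 / (1 - ρ)))) ^ 2 * ∑ k ∈ Finset.range n, v k ^ 2 := by
        simp only [sq_abs]; ring
    _ ≤ _ := by
        gcongr

/-- Within a period the feedthrough contributes a constant, so the derivative is the output of the
flow applied to `A x + B u`, linear in the state/input pair and uniformly bounded on the period. -/
theorem exists_response_bounds (G : CTSystem) {h : ℝ} (hh : 0 < h) : ∃ K : ℝ, 0 ≤ K ∧
    (∀ δ ∈ Set.Icc 0 h, ∀ z, |G.response δ z| ≤ K * ‖z‖) ∧
    ∀ δ ∈ Set.Icc 0 h, ∀ δ' ∈ Set.Icc 0 h, ∀ z,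
      |G.response δ z - G.response δ' z| ≤ K * |δ - δ'| * ‖z‖ := by
  obtain ⟨K, hK, hb⟩ := G.exists_norm_flow_le h
  have hsub : Set.Icc 0 h ⊆ Set.Icc (-h) h := Set.Icc_subset_Icc (by linarith) le_rfl
  let LA : (Fin G.n → ℝ) →L[ℝ] (Fin G.n → ℝ) := LinearMap.toContinuousLinearMap
    (Matrix.mulVecLin G.A)
  set K' := ‖G.out‖ * (K * (‖LA‖ + ‖G.B‖)) with hK'
  have hK'0 : 0 ≤ K' := by positivity
  have hd : ∀ z δ, HasDerivAt (fun δ => G.response δ z)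
      (G.out (G.flow δ (LA z.1 + z.2 • G.B))) δ := by
    intro z δ
    have h1 := (G.hasDerivAt_flow z.1 δ).add ((G.hasDerivAt_stepState δ).const_smul z.2)
    have h2 := (G.out.hasFDerivAt.comp_hasDerivAt δ h1).add_const (G.D * z.2)
    rw [map_add, map_smul]
    exact h2
  have hlip : ∀ δ ∈ Set.Icc 0 h, ∀ δ' ∈ Set.Icc 0 h, ∀ z,
      |G.response δ z - G.response δ' z| ≤ K' * ‖z‖ * |δ - δ'| := by
    intro δ hδ δ' hδ' z
    have := (convex_Icc 0 h).norm_image_sub_le_of_norm_hasDerivWithin_le (C := K' * ‖z‖)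
      (fun x _ => (hd z x).hasDerivWithinAt) (fun x hx => ?_) hδ' hδ
    · exact this
    · calc ‖G.out (G.flow x (LA z.1 + z.2 • G.B))‖
          ≤ ‖G.out‖ * ‖G.flow x (LA z.1 + z.2 • G.B)‖ := G.out.le_opNorm _
        _ ≤ ‖G.out‖ * (K * ‖LA z.1 + z.2 • G.B‖) := by gcongr; exact hb x (hsub hx) _
        _ ≤ ‖G.out‖ * (K * (‖LA‖ * ‖z‖ + ‖z‖ * ‖G.B‖)) := by
            gcongr
            refine (norm_add_le _ _).trans (add_le_add ?_ ?_)
            · exact (LA.le_opNorm _).trans (by gcongr; exact norm_fst_le z)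
            · rw [norm_smul]; gcongr; exact norm_snd_le z
        _ = K' * ‖z‖ := by rw [hK']; ring
  have hzero : ∀ z, |G.response 0 z| ≤ (‖G.out‖ + |G.D|) * ‖z‖ := by
    intro z
    simp only [response, flow_zero, stepState, intervalIntegral.integral_same, smul_zero, add_zero]
    refine (abs_add_le _ _).trans ?_
    rw [add_mul, abs_mul]
    refine add_le_add ?_ ?_
    · exact (G.out.le_opNorm _).trans (by gcongr; exact norm_fst_le z)
    · gcongr; exact norm_snd_le z
  refine ⟨K' * (1 + h) + (‖G.out‖ + |G.D|), by positivity, fun δ hδ z => ?_,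
    fun δ hδ δ' hδ' z => ?_⟩
  · have h1 := hlip δ hδ 0 ⟨le_rfl, hh.le⟩ z
    have h2 := hzero z
    have h3 : |G.response δ z| ≤ |G.response δ z - G.response 0 z| + |G.response 0 z| := by
      simpa using abs_add_le (G.response δ z - G.response 0 z) (G.response 0 z)
    rw [sub_zero, abs_of_nonneg hδ.1] at h1
    have h4 : K' * ‖z‖ * δ ≤ K' * ‖z‖ * h := by gcongr; exact hδ.2
    have h5 : 0 ≤ K' * ‖z‖ := by positivity
    nlinarith
  · refine (hlip δ hδ δ' hδ' z).trans ?_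
    have h5 : 0 ≤ (K' * h + (‖G.out‖ + |G.D|)) * |δ - δ'| * ‖z‖ := by positivity
    nlinarith

theorem IsStable.exists_L2Norm_io_le (hG : G.IsStable) {h : ℝ} (hh : 0 < h) :
    ∃ C : ℝ, 0 ≤ C ∧ ∀ τ, 0 < τ → τ ≤ h → ∀ v : ℕ → ℝ,
      L2Norm (G.io (hold τ v)) ≤ ENNReal.ofReal C * L2Norm (hold τ v) ∧
      L2Norm (interp τ (G.io (hold τ v)) - G.io (hold τ v))
        ≤ ENNReal.ofReal (C * τ) * L2Norm (hold τ v) := by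
  obtain ⟨C, hC, hx⟩ := hG.exists_sum_holdState_le h
  obtain ⟨K, hK, hb, hlip⟩ := G.exists_response_bounds hh
  refine ⟨K * √(C + 1), by positivity, fun τ hτ hτh v => ?_⟩
  -- Used with `s = 1` for the output itself and with `s = τ` for its oscillation over one sampling
  -- cell.
  have key : ∀ (g : ℝ → ℝ) (s : ℝ), 0 ≤ s → (∀ (k : ℕ) δ, 0 ≤ δ → δ < τ →
      |g (k * τ + δ)| ≤ K * s * ‖(G.holdState τ v k, v k)‖) →
      L2Norm g ≤ ENNReal.ofReal (K * √(C + 1) * s) * L2Norm (hold τ v) := by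
    intro g s hs hg
    have h1 := L2Norm_le_of_block hτ hg
    rw [← sq_le_sq_ennreal, mul_pow, L2Norm_hold_sq hτ]
    refine h1.trans ?_
    rw [mul_left_comm, ← ENNReal.ofReal_pow (by positivity)]
    gcongr
    refine tsum_enorm_sq_le (by positivity) fun n => ?_
    calc ∑ k ∈ Finset.range n, (K * s * ‖(G.holdState τ v k, v k)‖) ^ 2
        ≤ ∑ k ∈ Finset.range n, (K * s) ^ 2 * (‖G.holdState τ v k‖ ^ 2 + v k ^ 2) := by
          refine Finset.sum_le_sum fun k _ => ?_
          rw [mul_pow, Prod.norm_def]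
          gcongr
          rcases max_cases ‖G.holdState τ v k‖ ‖v k‖ with h | h
          · rw [h.1]; nlinarith [sq_nonneg (v k)]
          · rw [h.1, Real.norm_eq_abs, sq_abs]; nlinarith [sq_nonneg ‖G.holdState τ v k‖]
      _ = (K * s) ^ 2 * (∑ k ∈ Finset.range n, ‖G.holdState τ v k‖ ^ 2
            + ∑ k ∈ Finset.range n, v k ^ 2) := by
          rw [← Finset.mul_sum, Finset.sum_add_distrib]
      _ ≤ (K * s) ^ 2 * (C * ∑ k ∈ Finset.range n, v k ^ 2
            + ∑ k ∈ Finset.range n, v k ^ 2) := by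
          gcongr; exact hx τ hτ hτh v n
      _ = (K * √(C + 1) * s) ^ 2 * ∑ k ∈ Finset.range n, v k ^ 2 := by
          rw [mul_right_comm, mul_pow (K * s), Real.sq_sqrt (by positivity)]
          ring
  constructor
  · have := key (G.io (hold τ v)) 1 zero_le_one fun k δ h0 h1 => by
      rw [io_hold hτ v k h0 h1, mul_one]
      exact hb δ ⟨h0, (h1.trans_le hτh).le⟩ _
    rwa [mul_one] at this
  · refine key _ τ hτ.le fun k δ h0 h1 => ?_
    rw [Pi.sub_apply, interp_eq hτ _ k h0 h1, io_hold hτ v k h0 h1]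
    have e := io_hold (G := G) hτ v k le_rfl hτ
    rw [add_zero] at e
    rw [e]
    refine (hlip 0 ⟨le_rfl, hh.le⟩ δ ⟨h0, (h1.trans_le hτh).le⟩ _).trans ?_
    gcongr
    rw [zero_sub, abs_neg, abs_of_nonneg h0]
    exact h1.le

end CTSystem

/-! ### Interpolation error measured against the output -/

/-- On a finite-dimensional space, a preimage under a linear map can be chosen with control of
its norm. -/
theorem LinearMap.exists_preimage_norm_le {E F : Type*} [NormedAddCommGroup E] [NormedSpace ℝ E]
    [FiniteDimensional ℝ E] [NormedAddCommGroup F] [NormedSpace ℝ F] (L : E →ₗ[ℝ] F) :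
    ∃ C : ℝ, 0 ≤ C ∧ ∀ z, ∃ z', L z' = L z ∧ ‖z'‖ ≤ C * ‖L z‖ := by
  obtain ⟨s, hs⟩ := L.rangeRestrict.exists_rightInverse_of_surjective L.range_rangeRestrict
  let s' : LinearMap.range L →L[ℝ] E := LinearMap.toContinuousLinearMap s
  refine ⟨‖s'‖, norm_nonneg s', fun z => ⟨s' (L.rangeRestrict z), ?_, s'.le_opNorm _⟩⟩
  have := LinearMap.congr_fun hs (L.rangeRestrict z)
  exact congrArg Subtype.val this

namespace CTSystem

theorem continuous_response (G : CTSystem) (z : (Fin G.n → ℝ) × ℝ) :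
    Continuous fun δ => G.response δ z :=
  (G.out.continuous.comp ((G.continuous_flow_apply _).add
    (G.continuous_stepState.const_smul z.2))).add_const _

/-- The response to a hold input over one period is the response of a state/input pair controlled
by the energy of that response. -/
theorem exists_response_eq (G : CTSystem) {h : ℝ} (hh : 0 < h) : ∃ C : ℝ, 0 ≤ C ∧ ∀ z, ∃ z',
    (∀ δ ∈ Set.Ico 0 h, G.response δ z' = G.response δ z) ∧
    ENNReal.ofReal ‖z'‖ ^ 2
      ≤ ENNReal.ofReal C ^ 2 * ∫⁻ δ in Set.Ico 0 h, ‖G.response δ z‖ₑ ^ 2 := by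
  obtain ⟨K, hK, hb, -⟩ := G.exists_response_bounds hh
  set μ := (volume : Measure ℝ).restrict (Set.Ico 0 h) with hμ
  have : IsFiniteMeasure μ := ⟨by simp [hμ]⟩
  have hmem : ∀ z, MemLp (fun δ => G.response δ z) 2 μ := fun z =>
    MemLp.of_bound (G.continuous_response z).aestronglyMeasurable (K * ‖z‖)
      ((ae_restrict_iff' measurableSet_Ico).2 (ae_of_all _ fun δ hδ =>
        hb δ (Set.Ico_subset_Icc_self hδ) z))
  -- The kernel of `L` consists of the pairs invisible in the output. The energy of the response
  -- cannot control those, which is why `z` is replaced by another pair with the same response.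
  let L : ((Fin G.n → ℝ) × ℝ) →ₗ[ℝ] Lp ℝ 2 μ :=
    { toFun := fun z => (hmem z).toLp
      map_add' := fun z w => by
        rw [← MemLp.toLp_add]
        refine MemLp.toLp_congr _ _ (ae_of_all _ fun δ => ?_)
        simp only [response, Prod.fst_add, Prod.snd_add, map_add, add_smul, Pi.add_apply]
        ring
      map_smul' := fun c z => by
        rw [RingHom.id_apply, ← MemLp.toLp_const_smul]
        refine MemLp.toLp_congr _ _ (ae_of_all _ fun δ => ?_)
        simp only [response, Prod.smul_fst, Prod.smul_snd, map_add, map_smul, Pi.smul_apply,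
          smul_eq_mul]
        ring }
  obtain ⟨C, hC, hL⟩ := L.exists_preimage_norm_le
  refine ⟨C, hC, fun z => ?_⟩
  obtain ⟨z', h1, h2⟩ := hL z
  refine ⟨z', ?_, ?_⟩
  · have h3 := (MemLp.toLp_eq_toLp_iff (hmem z') (hmem z)).1 h1
    exact Measure.eqOn_Ico_of_ae_eq volume h3 (G.continuous_response z').continuousOn
      (G.continuous_response z).continuousOn
  · have h3 : ‖L z‖ = (eLpNorm (fun δ => G.response δ z) 2 μ).toReal :=
      Lp.norm_toLp _ (hmem z)
    have h4 : eLpNorm (fun δ => G.response δ z) 2 μ ^ 2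
        = ∫⁻ δ in Set.Ico 0 h, ‖G.response δ z‖ₑ ^ 2 := by
      rw [eLpNorm_eq_lintegral_rpow_enorm_toReal (by norm_num) (by norm_num),
        ← ENNReal.rpow_natCast, ← ENNReal.rpow_mul]
      norm_num
      rfl
    rw [← h4, ← mul_pow, ← ENNReal.ofReal_toReal (hmem z).eLpNorm_ne_top, ← h3,
      ← ENNReal.ofReal_mul hC]
    gcongr

theorem _root_.floor_div_mul_add {h τ : ℝ} {N : ℕ} (hτ : 0 < τ) (hN : h = N * τ) (k : ℕ) {δ : ℝ}
    (hδ : 0 ≤ δ) : (⌊(k * h + δ) / τ⌋₊ : ℝ) * τ = k * h + ⌊δ / τ⌋₊ * τ := by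
  have : (k * h + δ) / τ = δ / τ + (k * N : ℕ) := by
    rw [hN]; push_cast; field_simp; ring
  rw [this, Nat.floor_add_natCast (div_nonneg hδ hτ.le)]
  push_cast
  rw [hN]
  ring

/-- The Lipschitz constant of the output on a period is controlled by its energy on that same
period. The estimate is thus local in time, and growth of the state plays no role. -/
theorem exists_L2Norm_interp_sub_le (G : CTSystem) {h : ℝ} (hh : 0 < h) :
    ∃ C : ℝ, 0 ≤ C ∧ ∀ (N : ℕ), 0 < N → ∀ c : ℕ → ℝ,
      L2Norm (interp (h / N) (G.io (hold h c)) - G.io (hold h c))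
        ≤ ENNReal.ofReal (C * (h / N)) * L2Norm (G.io (hold h c)) := by
  obtain ⟨K, hK, -, hlip⟩ := G.exists_response_bounds hh
  obtain ⟨C, hC, hz⟩ := G.exists_response_eq hh
  refine ⟨K * C * √h, by positivity, fun N hN c => ?_⟩
  have hN' : (0 : ℝ) < N := by exact_mod_cast hN
  set τ := h / N with hτ
  have hτ0 : 0 < τ := by positivity
  have hhτ : h = N * τ := by rw [hτ]; field_simp
  rw [← sq_le_sq_ennreal, mul_pow, L2Norm_sq, L2Norm_sq, lintegral_Ici_eq_tsum hh,
    lintegral_Ici_eq_tsum hh, ← ENNReal.tsum_mul_left]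
  refine ENNReal.tsum_le_tsum fun k => ?_
  obtain ⟨z, hz1, hz2⟩ := hz (G.holdState h c k, c k)
  have hpt : ∀ δ ∈ Set.Ico 0 h,
      ‖(interp τ (G.io (hold h c)) - G.io (hold h c)) (k * h + δ)‖ₑ ^ 2
        ≤ ENNReal.ofReal (K * τ * ‖z‖) ^ 2 := by
    intro δ hδ
    set j := ⌊δ / τ⌋₊ with hj
    have hj1 : (j : ℝ) * τ ≤ δ := by
      rw [← le_div_iff₀ hτ0]; exact Nat.floor_le (div_nonneg hδ.1 hτ0.le)
    have hj2 : δ < (j + 1) * τ := by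
      rw [← div_lt_iff₀ hτ0]; exact Nat.lt_floor_add_one _
    have hjI : (j : ℝ) * τ ∈ Set.Ico 0 h := ⟨by positivity, hj1.trans_lt hδ.2⟩
    rw [Pi.sub_apply, interp_apply, floor_div_mul_add hτ0 hhτ k hδ.1, io_hold hh c k hjI.1 hjI.2,
      io_hold hh c k hδ.1 hδ.2, ← hz1 _ hjI, ← hz1 _ hδ, Real.enorm_eq_ofReal_abs]
    gcongr
    refine (hlip _ (Set.Ico_subset_Icc_self hjI) _ (Set.Ico_subset_Icc_self hδ) z).trans ?_
    gcongr
    rw [abs_le]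
    constructor <;> linarith
  have hresp : ∫⁻ δ in Set.Ico 0 h, ‖G.io (hold h c) (k * h + δ)‖ₑ ^ 2
      = ∫⁻ δ in Set.Ico 0 h, ‖G.response δ (G.holdState h c k, c k)‖ₑ ^ 2 :=
    setLIntegral_congr_fun measurableSet_Ico fun δ hδ => by
      simp only [io_hold hh c k hδ.1 hδ.2]
  rw [hresp]
  set I := ∫⁻ δ in Set.Ico 0 h, ‖G.response δ (G.holdState h c k, c k)‖ₑ ^ 2
  calc ∫⁻ δ in Set.Ico 0 h, ‖(interp τ (G.io (hold h c)) - G.io (hold h c)) (k * h + δ)‖ₑ ^ 2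
      ≤ ∫⁻ _ in Set.Ico 0 h, ENNReal.ofReal (K * τ * ‖z‖) ^ 2 :=
        setLIntegral_mono' measurableSet_Ico hpt
    _ = ENNReal.ofReal (K * τ) ^ 2 * ENNReal.ofReal (√h) ^ 2 * ENNReal.ofReal ‖z‖ ^ 2 := by
        rw [setLIntegral_const, Real.volume_Ico, sub_zero, ENNReal.ofReal_mul (by positivity),
          ← ENNReal.ofReal_pow (Real.sqrt_nonneg h), Real.sq_sqrt hh.le]
        ring
    _ ≤ ENNReal.ofReal (K * τ) ^ 2 * ENNReal.ofReal (√h) ^ 2 * (ENNReal.ofReal C ^ 2 * I) := by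
        gcongr
    _ = ENNReal.ofReal (K * C * √h * τ) ^ 2 * I := by
        rw [show K * C * √h * τ = K * τ * √h * C by ring,
          ENNReal.ofReal_mul (p := K * τ * √h) (by positivity),
          ENNReal.ofReal_mul (p := K * τ) (by positivity)]
        ring

end CTSystem

/-! ### Delays, measurability and the upper bound -/

theorem L2Norm_congr {f g : ℝ → ℝ} (h : ∀ t, 0 ≤ t → f t = g t) : L2Norm f = L2Norm g :=
  eLpNorm_congr_ae ((ae_restrict_iff' measurableSet_Ici).2 (ae_of_all _ h))

theorem L2Norm_ctDelay_le {T : ℝ} (f : ℝ → ℝ) : L2Norm (ctDelay T f) ≤ L2Norm f := by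
  rw [← sq_le_sq_ennreal, L2Norm_sq, L2Norm_sq]
  have e : (fun t => ‖ctDelay T f t‖ₑ ^ 2)
      = (Set.Ici T).indicator fun t => ‖f (t - T)‖ₑ ^ 2 := by
    funext t
    by_cases ht : T ≤ t
    · simp [ctDelay, ht]
    · simp [ctDelay, ht]
  have hmp := measurePreserving_add_left (volume : Measure ℝ) T
  have h1 := hmp.setLIntegral_comp_preimage_emb (measurableEmbedding_addLeft T)
    (fun t => ‖f (t - T)‖ₑ ^ 2) (Set.Ici T)
  calc ∫⁻ t in Set.Ici 0, ‖ctDelay T f t‖ₑ ^ 2 ≤ ∫⁻ t, ‖ctDelay T f t‖ₑ ^ 2 :=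
        setLIntegral_le_lintegral _ _
    _ = ∫⁻ t in Set.Ici T, ‖f (t - T)‖ₑ ^ 2 := by rw [e, lintegral_indicator measurableSet_Ici]
    _ = ∫⁻ t in Set.Ici 0, ‖f t‖ₑ ^ 2 := by
        rw [← h1]
        simp
    _ ≤ _ := le_rfl

theorem measurable_ctDelay {T : ℝ} {f : ℝ → ℝ} (hf : Measurable f) : Measurable (ctDelay T f) :=
  Measurable.ite measurableSet_Ici (hf.comp (measurable_id.sub_const T)) measurable_const

/-- Interpolation commutes with delays by multiples of the sampling period. -/
theorem interp_ctDelay {τ : ℝ} (hτ : 0 < τ) (j : ℕ) (f : ℝ → ℝ) {t : ℝ} (ht : 0 ≤ t) :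
    interp τ (ctDelay (j * τ) f) t = ctDelay (j * τ) (interp τ f) t := by
  have h1 : (j : ℝ) * τ ≤ ⌊t / τ⌋₊ * τ ↔ (j : ℝ) * τ ≤ t := by
    rw [mul_le_mul_iff_left₀ hτ, Nat.cast_le, Nat.le_floor_iff (by positivity), le_div_iff₀ hτ]
  rw [interp_apply, ctDelay, ctDelay]
  simp only [h1]
  split_ifs with h2
  · rw [interp_apply]
    have h3 : (t - j * τ) / τ = t / τ - j := by field_simp
    rw [h3, Nat.floor_sub_natCast, Nat.cast_sub, sub_mul]
    rwa [Nat.le_floor_iff (by positivity), le_div_iff₀ hτ]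
  · rfl

theorem L2Norm_interp_ctDelay_sub_le {τ : ℝ} (hτ : 0 < τ) (j : ℕ) (f : ℝ → ℝ) :
    L2Norm (interp τ (ctDelay (j * τ) f) - ctDelay (j * τ) f) ≤ L2Norm (interp τ f - f) := by
  refine le_trans (le_of_eq (L2Norm_congr fun t ht => ?_))
    (L2Norm_ctDelay_le (T := j * τ) (interp τ f - f))
  rw [Pi.sub_apply, interp_ctDelay hτ j f ht]
  simp only [ctDelay]
  split_ifs <;> simp

theorem measurable_interp (τ : ℝ) (g : ℝ → ℝ) : Measurable (interp τ g) := measurable_hold τ _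

theorem CTSystem.continuous_flow_pullState {G : CTSystem} {u : ℝ → ℝ}
    (hu : ∀ a b, IntervalIntegrable u volume a b) :
    Continuous fun t => G.flow t (G.pullState u t) :=
  G.continuous_flow.comp (continuous_id.prodMk
    (intervalIntegral.continuous_primitive (fun a b => intervalIntegrable_pull (hu a b)) 0))

theorem CTSystem.measurable_io {G : CTSystem} {u : ℝ → ℝ} (hm : Measurable u)
    (hu : ∀ a b, IntervalIntegrable u volume a b) : Measurable (G.io u) := by
  have : G.io u = fun t => G.out (G.flow t (G.pullState u t)) + G.D * u t :=
    funext fun t => io_eq (hu _ _)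
  rw [this]
  exact (G.out.continuous.comp (continuous_flow_pullState hu)).measurable.add (hm.const_mul _)

theorem L2Norm_add_le {f g : ℝ → ℝ} (hf : Measurable f) (hg : Measurable g) :
    L2Norm (f + g) ≤ L2Norm f + L2Norm g :=
  eLpNorm_add_le hf.aestronglyMeasurable hg.aestronglyMeasurable (by norm_num)

theorem L2Norm_sub_le {f g : ℝ → ℝ} (hf : Measurable f) (hg : Measurable g) :
    L2Norm (f - g) ≤ L2Norm f + L2Norm g :=
  eLpNorm_sub_le hf.aestronglyMeasurable hg.aestronglyMeasurable (by norm_num)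

/-- The induced norms of the discretizations exceed the induced norm of the error system by at
most a quantity of the order of the fast sampling period. -/
theorem exists_inducedNorml2_le (F P : CTSystem) (hF : F.IsStable) (H : (ℕ → ℝ) → ℕ → ℝ) (M m : ℕ)
    {h : ℝ} (hh : 0 < h) : ∃ C : ℝ, 0 ≤ C ∧ ∀ N : ℕ, 0 < N →
      inducedNorml2 (fsfh h N (decimErrorSystem F P H M m h))
        ≤ inducedNormL2 (decimErrorSystem F P H M m h)
          + ENNReal.ofReal (C * (h / N)) * (inducedNormL2 (decimErrorSystem F P H M m h) + 1) := by
  obtain ⟨C₁, hC₁, hF'⟩ := hF.exists_L2Norm_io_le hh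
  obtain ⟨C₂, hC₂, hP'⟩ := P.exists_L2Norm_interp_sub_le hh
  refine ⟨C₁ + C₂ * C₁ + C₂, by positivity, fun N hN => ?_⟩
  set T := decimErrorSystem F P H M m h with hT
  set c := inducedNormL2 T with hc
  have hN' : (0 : ℝ) < N := by exact_mod_cast hN
  have hN1 : (1 : ℝ) ≤ N := by exact_mod_cast hN
  set τ := h / N with hτ
  have hτ0 : 0 < τ := by positivity
  have hτh : τ ≤ h := div_le_self hh.le hN1
  -- The delay is a whole number of fast periods, so it commutes with interpolation.
  have hmh : (m : ℝ) * h = (m * N : ℕ) * τ := by rw [hτ]; push_cast; field_simp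
  refine inducedNorml2_fsfh_le hh hN T fun x h1 h0 => ?_
  set w := hold τ x with hw
  set y := P.io (hold h (downsample M (H (sampler (h / M) (F.io w))))) with hy
  set fd := ctDelay (m * h) (F.io w) with hfd
  have hTw : T w = fd - y := rfl
  have hmw : Measurable w := measurable_hold τ x
  have hmfd : Measurable fd :=
    measurable_ctDelay (CTSystem.measurable_io hmw (intervalIntegrable_hold hτ0 x))
  have hmy : Measurable y :=
    CTSystem.measurable_io (measurable_hold _ _) (intervalIntegrable_hold hh _)
  have hb : L2Norm (T w) ≤ c * L2Norm w := by
    rw [← ENNReal.div_le_iff h0 h1]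
    exact le_iSup_of_le w (le_iSup_of_le ⟨hmw.aestronglyMeasurable, lt_top_iff_ne_top.2 h1⟩
      (le_iSup_of_le h0 le_rfl))
  obtain ⟨hf1, hf2⟩ := hF' τ hτ0 hτh x
  have e1 : L2Norm (interp τ fd - fd) ≤ ENNReal.ofReal (C₁ * τ) * L2Norm w := by
    rw [hfd, hmh]
    exact (L2Norm_interp_ctDelay_sub_le hτ0 _ _).trans hf2
  -- The output of `P` is bounded through `y = fd - T w`, hence by the gain `c` of the error system
  -- rather than by any gain of the filter.
  have e2 : L2Norm y ≤ ENNReal.ofReal C₁ * L2Norm w + c * L2Norm w := by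
    have : y = fd - T w := by rw [hTw]; abel
    rw [this]
    refine (L2Norm_sub_le hmfd (hmfd.sub hmy)).trans (add_le_add ?_ hb)
    exact (L2Norm_ctDelay_le _).trans hf1
  have e3 : L2Norm (interp τ y - y)
      ≤ ENNReal.ofReal (C₂ * τ) * (ENNReal.ofReal C₁ * L2Norm w + c * L2Norm w) :=
    (hP' N hN _).trans (mul_le_mul_right e2 _)
  have e4 : interp τ (T w) = T w + ((interp τ fd - fd) - (interp τ y - y)) := by
    funext t
    simp only [hTw, interp_apply, Pi.add_apply, Pi.sub_apply]
    ring
  rw [e4]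
  calc L2Norm (T w + ((interp τ fd - fd) - (interp τ y - y)))
      ≤ c * L2Norm w + (ENNReal.ofReal (C₁ * τ) * L2Norm w
          + ENNReal.ofReal (C₂ * τ) * (ENNReal.ofReal C₁ * L2Norm w + c * L2Norm w)) := by
        have m1 := (measurable_interp τ fd).sub hmfd
        have m2 := (measurable_interp τ y).sub hmy
        refine (L2Norm_add_le (hmfd.sub hmy) (m1.sub m2)).trans (add_le_add hb ?_)
        exact (L2Norm_sub_le m1 m2).trans (add_le_add e1 e3)
    _ = (c + ENNReal.ofReal τ * (ENNReal.ofReal C₂ * c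
          + (ENNReal.ofReal C₁ + ENNReal.ofReal C₂ * ENNReal.ofReal C₁))) * L2Norm w := by
        rw [ENNReal.ofReal_mul hC₁, ENNReal.ofReal_mul hC₂]
        ring
    _ ≤ (c + ENNReal.ofReal ((C₁ + C₂ * C₁ + C₂) * τ) * (c + 1)) * L2Norm w := by
        refine mul_le_mul' (add_le_add le_rfl ?_) le_rfl
        rw [ENNReal.ofReal_mul (by positivity), mul_comm (ENNReal.ofReal (_ + _)), mul_assoc]
        refine mul_le_mul' le_rfl ?_
        rw [ENNReal.ofReal_add (by positivity) hC₂, ENNReal.ofReal_add hC₁ (by positivity),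
          ENNReal.ofReal_mul hC₂, mul_add, mul_one]
        refine add_le_add ?_ le_self_add
        gcongr
        exact le_add_self

/-! ### Approximation of square integrable signals by hold signals -/

theorem abs_floor_div_mul_sub_le {τ t : ℝ} (hτ : 0 < τ) (ht : 0 ≤ t) :
    |(⌊t / τ⌋₊ : ℝ) * τ - t| ≤ τ := by
  have h1 : (⌊t / τ⌋₊ : ℝ) * τ ≤ t := by
    rw [← le_div_iff₀ hτ]; exact Nat.floor_le (by positivity)
  have h2 : t < (⌊t / τ⌋₊ + 1) * τ := by
    rw [← div_lt_iff₀ hτ]; exact Nat.lt_floor_add_one _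
  rw [abs_le]
  constructor <;> linarith

theorem tendsto_floor_div_mul {τ : ℕ → ℝ} (hτ : ∀ᶠ l in atTop, 0 < τ l)
    (hτ0 : Tendsto τ atTop (𝓝 0)) {t : ℝ} (ht : 0 ≤ t) :
    Tendsto (fun l => (⌊t / τ l⌋₊ : ℝ) * τ l) atTop (𝓝 t) := by
  rw [tendsto_iff_norm_sub_tendsto_zero]
  refine squeeze_zero' (Eventually.of_forall fun _ => norm_nonneg _) ?_ hτ0
  filter_upwards [hτ] with l hl
  exact abs_floor_div_mul_sub_le hl ht

theorem tendsto_L2Norm_of_sq {f : ℕ → ℝ → ℝ}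
    (h : Tendsto (fun l => L2Norm (f l) ^ 2) atTop (𝓝 0)) :
    Tendsto (fun l => L2Norm (f l)) atTop (𝓝 0) := by
  rw [ENNReal.tendsto_nhds_zero] at h ⊢
  intro ε hε
  filter_upwards [h (ε ^ 2) (by positivity)] with l hl
  exact sq_le_sq_ennreal.1 hl

theorem tendsto_L2Norm_interp_sub {τ : ℕ → ℝ} (hτ : ∀ᶠ l in atTop, 0 < τ l)
    (hτ0 : Tendsto τ atTop (𝓝 0)) {φ : ℝ → ℝ} (hφ : Continuous φ) (hc : HasCompactSupport φ) :
    Tendsto (fun l => L2Norm (interp (τ l) φ - φ)) atTop (𝓝 0) := by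
  refine tendsto_L2Norm_of_sq ?_
  simp only [L2Norm_sq]
  obtain ⟨B, hB⟩ := hφ.bounded_above_of_compact_support hc
  obtain ⟨R, hR⟩ := hc.isCompact.isBounded.subset_closedBall 0
  have hzero : ∀ t, R < t → φ t = 0 := by
    intro t ht
    by_contra hne
    have := hR (subset_tsupport φ hne)
    rw [Metric.mem_closedBall, dist_zero_right, Real.norm_eq_abs] at this
    linarith [le_abs_self t]
  -- Once `τ l < 1`, the sampling instant used at a time `t > R + 1` still exceeds `R`, so both
  -- functions vanish there and the constant bound is needed on a bounded interval only.
  have hlim := tendsto_lintegral_filter_of_dominated_convergence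
    (μ := volume.restrict (Set.Ici 0)) (l := atTop)
    (F := fun l t => ‖(interp (τ l) φ - φ) t‖ₑ ^ 2) (f := fun _ => 0)
    ((Set.Iic (R + 1)).indicator fun _ => ENNReal.ofReal (2 * B) ^ 2)
    (Eventually.of_forall fun l =>
      (((measurable_interp (τ l) φ).sub hφ.measurable).enorm.pow_const 2)) ?_ ?_ ?_
  · simpa using hlim
  · filter_upwards [hτ, hτ0.eventually (gt_mem_nhds zero_lt_one)] with l hl hl1
    refine (ae_restrict_iff' measurableSet_Ici).2 (ae_of_all _ fun t ht => ?_)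
    by_cases h1 : t ≤ R + 1
    · rw [Set.indicator_of_mem (by exact h1), Real.enorm_eq_ofReal_abs]
      gcongr
      refine (abs_sub _ _).trans ?_
      have e1 := hB (⌊t / τ l⌋₊ * τ l)
      have e2 := hB t
      rw [Real.norm_eq_abs] at e1 e2
      rw [interp_apply]
      linarith
    · have h2 := (abs_le.1 (abs_floor_div_mul_sub_le hl ht)).1
      rw [Pi.sub_apply, interp_apply, hzero t (by linarith), hzero _ (by linarith)]
      simp
  · rw [lintegral_indicator measurableSet_Iic, Measure.restrict_restrict measurableSet_Iic,
      setLIntegral_const]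
    refine ENNReal.mul_ne_top (ENNReal.pow_ne_top ENNReal.ofReal_ne_top) ?_
    rw [Set.inter_comm, Set.Ici_inter_Iic]
    simp
  · refine (ae_restrict_iff' measurableSet_Ici).2 (ae_of_all _ fun t ht => ?_)
    have h1 : Tendsto (fun l => (interp (τ l) φ - φ) t) atTop (𝓝 0) := by
      have := ((hφ.tendsto t).comp (tendsto_floor_div_mul hτ hτ0 ht)).sub_const (φ t)
      rw [sub_self] at this
      exact this
    have h2 := (ENNReal.continuous_pow 2).tendsto _ |>.comp ((continuous_enorm.tendsto _).comp h1)
    simp only [enorm_zero, ne_eq, OfNat.ofNat_ne_zero, not_false_eq_true, zero_pow] at h2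
    exact h2

/-- Square integrable signals are limits of piecewise constant signals. -/
theorem exists_tendsto_hold {τ : ℕ → ℝ} (hτ : ∀ᶠ l in atTop, 0 < τ l)
    (hτ0 : Tendsto τ atTop (𝓝 0)) {w : ℝ → ℝ} (hw : MemLp w 2 (volume.restrict (Set.Ici 0))) :
    ∃ v : ℕ → ℕ → ℝ, Tendsto (fun l => L2Norm (hold (τ l) (v l) - w)) atTop (𝓝 0) := by
  set d : ℕ → ℝ≥0∞ := fun l => ⨅ x : ℕ → ℝ, L2Norm (hold (τ l) x - w) with hd
  have hlim : Tendsto d atTop (𝓝 0) := by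
    rw [ENNReal.tendsto_nhds_zero]
    intro ε hε
    have hε2 : ε / 2 ≠ 0 := (ENNReal.half_pos hε.ne').ne'
    have hw' : MemLp ((Set.Ici 0).indicator w) 2 volume :=
      (memLp_indicator_iff_restrict measurableSet_Ici).2 hw
    obtain ⟨φ, hc, hφ, hcont, -⟩ := hw'.exists_hasCompactSupport_eLpNorm_sub_le (by norm_num) hε2
    have h1 : L2Norm (φ - w) ≤ ε / 2 := by
      have e : L2Norm (φ - w) = L2Norm ((Set.Ici 0).indicator w - φ) := by
        rw [L2Norm, eLpNorm_sub_comm]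
        refine L2Norm_congr fun t ht => ?_
        simp [Set.indicator_of_mem (show t ∈ Set.Ici (0 : ℝ) from ht)]
      rw [e]
      exact (eLpNorm_mono_measure _ Measure.restrict_le_self).trans hφ
    have h2 := ENNReal.tendsto_nhds_zero.1 (tendsto_L2Norm_interp_sub hτ hτ0 hcont hc) (ε / 2)
      hε2.bot_lt
    filter_upwards [h2] with l hl
    refine (iInf_le _ (sampler (τ l) φ)).trans ?_
    have e : hold (τ l) (sampler (τ l) φ) - w = (interp (τ l) φ - φ) + (φ - w) := by
      rw [interp]; abel
    rw [e, ← ENNReal.add_halves ε]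
    refine (eLpNorm_add_le ?_ ?_ (by norm_num)).trans (add_le_add hl h1)
    · exact ((measurable_interp (τ l) φ).sub hcont.measurable).aestronglyMeasurable
    · exact hcont.aestronglyMeasurable.sub hw.aestronglyMeasurable
  -- Near-minimizers of the distance `d l`; for `l = 0` the tolerance is `∞`, which is harmless.
  have hex : ∀ l : ℕ, ∃ x : ℕ → ℝ, L2Norm (hold (τ l) x - w) ≤ d l + ((l : ℝ≥0∞))⁻¹ := by
    intro l
    by_cases htop : d l = ∞
    · exact ⟨0, by simp [htop]⟩
    · obtain ⟨x, hx⟩ := iInf_lt_iff.1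
        (ENNReal.lt_add_right htop (ENNReal.inv_ne_zero.2 (ENNReal.natCast_ne_top l)))
      exact ⟨x, hx.le⟩
  choose v hv using hex
  refine ⟨v, tendsto_of_tendsto_of_tendsto_of_le_of_le tendsto_const_nhds ?_
    (fun _ => zero_le) hv⟩
  simpa using hlim.add ENNReal.tendsto_inv_nat_nhds_zero

theorem tendsto_L2Norm {u : ℕ → ℝ → ℝ} {w : ℝ → ℝ}
    (hu : ∀ l, AEStronglyMeasurable (u l) (volume.restrict (Set.Ici 0)))
    (hw : MemLp w 2 (volume.restrict (Set.Ici 0)))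
    (h : Tendsto (fun l => L2Norm (u l - w)) atTop (𝓝 0)) :
    Tendsto (fun l => L2Norm (u l)) atTop (𝓝 (L2Norm w)) := by
  have h1 : Tendsto (fun l => L2Norm w + L2Norm (u l - w)) atTop (𝓝 (L2Norm w)) := by
    simpa using h.const_add (L2Norm w)
  have h2 : Tendsto (fun l => L2Norm w - L2Norm (u l - w)) atTop (𝓝 (L2Norm w)) := by
    simpa using ENNReal.Tendsto.sub (tendsto_const_nhds (x := L2Norm w)) h
      (Or.inl hw.eLpNorm_ne_top)
  refine tendsto_of_tendsto_of_tendsto_of_le_of_le h2 h1 (fun l => ?_) fun l => ?_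
  · rw [tsub_le_iff_right]
    have e : w = u l - (u l - w) := by abel
    conv_lhs => rw [e]
    exact eLpNorm_sub_le (hu l) ((hu l).sub hw.aestronglyMeasurable) (by norm_num)
  · have e : u l = w + (u l - w) := by abel
    conv_lhs => rw [e]
    exact eLpNorm_add_le hw.aestronglyMeasurable ((hu l).sub hw.aestronglyMeasurable) (by norm_num)

theorem intervalIntegrable_of_memLp {w : ℝ → ℝ} (hw : MemLp w 2 (volume.restrict (Set.Ici 0)))
    {a b : ℝ} (ha : 0 ≤ a) (hb : 0 ≤ b) : IntervalIntegrable w volume a b := by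
  have h1 := ((memLp_indicator_iff_restrict measurableSet_Ici).2 hw).locallyIntegrable
    (by norm_num)
  have h2 : IntervalIntegrable ((Set.Ici 0).indicator w) volume a b :=
    (h1.integrableOn_isCompact isCompact_uIcc).intervalIntegrable
  refine h2.congr fun t ht => ?_
  have : t ∈ Set.Ici (0 : ℝ) := by
    rcases Set.mem_uIoc.1 ht with h | h
    · exact ha.trans h.1.le
    · exact hb.trans h.1.le
  exact Set.indicator_of_mem this w

/-! ### Pointwise convergence of the outputs -/

namespace CTSystem

variable {G : CTSystem}

theorem continuousOn_pullState {w : ℝ → ℝ} (hw : MemLp w 2 (volume.restrict (Set.Ici 0))) :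
    ContinuousOn (G.pullState w) (Set.Ici 0) := by
  have h1 := ((memLp_indicator_iff_restrict measurableSet_Ici).2 hw).locallyIntegrable
    (by norm_num)
  have h2 : ∀ a b, IntervalIntegrable ((Set.Ici 0).indicator w) volume a b := fun a b =>
    (h1.integrableOn_isCompact isCompact_uIcc).intervalIntegrable
  have h3 : Continuous (G.pullState ((Set.Ici 0).indicator w)) :=
    intervalIntegral.continuous_primitive (fun a b => intervalIntegrable_pull (h2 a b)) 0
  refine h3.continuousOn.congr fun t ht => ?_
  refine intervalIntegral.integral_congr fun s hs => ?_
  rw [Set.uIcc_of_le ht] at hs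
  simp only [Set.indicator_of_mem (show s ∈ Set.Ici (0 : ℝ) from hs.1)]

/-- The flow is bounded on `[-R, 0]` and the L¹ norm on a bounded interval is controlled by the L²
norm. Uniformity in `s` allows the evaluation time to vary with the input. -/
theorem exists_enorm_pullState_sub_le (G : CTSystem) (R : ℝ) : ∃ C : ℝ≥0∞, C ≠ ∞ ∧
    ∀ u w : ℝ → ℝ, MemLp w 2 (volume.restrict (Set.Ici 0)) →
      (∀ a b, IntervalIntegrable u volume a b) → ∀ s ∈ Set.Icc 0 R,
      ‖G.pullState u s - G.pullState w s‖ₑ ≤ C * L2Norm (u - w) := by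
  obtain ⟨K, hK, hb⟩ := G.exists_norm_flow_le R
  refine ⟨ENNReal.ofReal (K * ‖G.B‖) * volume (Set.Ioc 0 R) ^ (1 / (1 : ℝ) - 1 / 2),
    ENNReal.mul_ne_top ENNReal.ofReal_ne_top
      (ENNReal.rpow_ne_top_of_nonneg (by norm_num) (by simp)), fun u w hw hu s hs => ?_⟩
  have hwi := intervalIntegrable_of_memLp hw le_rfl hs.1
  have e : G.pullState u s - G.pullState w s
      = ∫ r in Set.Ioc 0 s, (u - w) r • G.flow (-r) G.B := by
    rw [pullState, pullState, ← intervalIntegral.integral_sub (intervalIntegrable_pull (hu _ _))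
      (intervalIntegrable_pull hwi), intervalIntegral.integral_of_le hs.1]
    simp only [Pi.sub_apply, sub_smul]
  have hsub : Set.Ioc 0 s ⊆ Set.Ioc 0 R := Set.Ioc_subset_Ioc_right hs.2
  have hmeas : AEStronglyMeasurable (u - w) (volume.restrict (Set.Ioc 0 R)) :=
    ((hu 0 R).1.aestronglyMeasurable).sub
      (hw.aestronglyMeasurable.mono_measure (Measure.restrict_mono
        (fun r hr => hr.1.le) le_rfl))
  rw [e]
  calc ‖∫ r in Set.Ioc 0 s, (u - w) r • G.flow (-r) G.B‖ₑ
      ≤ ∫⁻ r in Set.Ioc 0 s, ‖(u - w) r • G.flow (-r) G.B‖ₑ := enorm_integral_le_lintegral_enorm _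
    _ ≤ ∫⁻ r in Set.Ioc 0 R, ‖(u - w) r • G.flow (-r) G.B‖ₑ := lintegral_mono_set hsub
    _ ≤ ∫⁻ r in Set.Ioc 0 R, ENNReal.ofReal (K * ‖G.B‖) * ‖(u - w) r‖ₑ := by
        refine setLIntegral_mono' measurableSet_Ioc fun r hr => ?_
        rw [enorm_smul, mul_comm]
        gcongr
        rw [← ofReal_norm]
        exact ENNReal.ofReal_le_ofReal (hb (-r) ⟨by linarith [hr.2], by linarith [hr.1, hr.2]⟩ _)
    _ = ENNReal.ofReal (K * ‖G.B‖) * eLpNorm (u - w) 1 (volume.restrict (Set.Ioc 0 R)) := by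
        rw [lintegral_const_mul' _ _ ENNReal.ofReal_ne_top, eLpNorm_one_eq_lintegral_enorm]
    _ ≤ ENNReal.ofReal (K * ‖G.B‖) * (eLpNorm (u - w) 2 (volume.restrict (Set.Ioc 0 R))
          * volume (Set.Ioc 0 R) ^ (1 / (1 : ℝ) - 1 / 2)) := by
        gcongr
        have := eLpNorm_le_eLpNorm_mul_rpow_measure_univ (p := 1) (q := 2) (by norm_num) hmeas
        simpa using this
    _ ≤ ENNReal.ofReal (K * ‖G.B‖) * (L2Norm (u - w)
          * volume (Set.Ioc 0 R) ^ (1 / (1 : ℝ) - 1 / 2)) := by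
        gcongr
        exact eLpNorm_mono_measure _ (Measure.restrict_mono (fun r hr => hr.1.le) le_rfl)
    _ = _ := by ring

/-- Outputs of a strictly proper system depend continuously on the input and on time. -/
theorem tendsto_io (hD : G.D = 0) {u : ℕ → ℝ → ℝ} {w : ℝ → ℝ}
    (hw : MemLp w 2 (volume.restrict (Set.Ici 0)))
    (hu : ∀ᶠ l in atTop, ∀ a b, IntervalIntegrable (u l) volume a b)
    (hlim : Tendsto (fun l => L2Norm (u l - w)) atTop (𝓝 0)) {s : ℕ → ℝ} {t : ℝ}
    (hs0 : ∀ᶠ l in atTop, 0 ≤ s l) (hs : Tendsto s atTop (𝓝 t)) :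
    Tendsto (fun l => G.io (u l) (s l)) atTop (𝓝 (G.io w t)) := by
  have ht : 0 ≤ t := ge_of_tendsto hs hs0
  obtain ⟨C, hC, hb⟩ := G.exists_enorm_pullState_sub_le (t + 1)
  have h1 : Tendsto (fun l => G.pullState w (s l)) atTop (𝓝 (G.pullState w t)) :=
    (continuousOn_pullState hw t ht).tendsto.comp (tendsto_nhdsWithin_iff.2 ⟨hs, hs0⟩)
  have h2 : Tendsto (fun l => G.pullState (u l) (s l) - G.pullState w (s l)) atTop (𝓝 0) := by
    rw [tendsto_zero_iff_enorm_tendsto_zero]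
    have h3 : Tendsto (fun l => C * L2Norm (u l - w)) atTop (𝓝 0) := by
      simpa using ENNReal.Tendsto.const_mul hlim (Or.inr hC)
    refine tendsto_of_tendsto_of_tendsto_of_le_of_le' tendsto_const_nhds h3
      (Eventually.of_forall fun _ => zero_le) ?_
    filter_upwards [hu, hs0, hs.eventually (gt_mem_nhds (lt_add_one t))] with l h4 h5 h6
    exact hb _ _ hw h4 _ ⟨h5, h6.le⟩
  have h3 : Tendsto (fun l => G.pullState (u l) (s l)) atTop (𝓝 (G.pullState w t)) := by
    simpa using h2.add h1
  have h4 := (G.out.continuous.tendsto _).comp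
    ((G.continuous_flow.tendsto (t, G.pullState w t)).comp (hs.prodMk_nhds h3))
  rw [io_eq (intervalIntegrable_of_memLp hw le_rfl ht), hD, zero_mul, add_zero]
  refine h4.congr' ?_
  filter_upwards [hu] with l hl
  rw [io_eq (hl _ _), hD, zero_mul, add_zero]
  rfl

theorem continuous_holdState (G : CTSystem) (τ : ℝ) (k : ℕ) :
    Continuous fun v => G.holdState τ v k := by
  induction k with
  | zero => exact continuous_const
  | succ k ih =>
    exact ((G.flow τ).continuous.comp ih).add ((continuous_apply k).smul continuous_const)

/-- The fast period divides `h`, so the instant `⌊t / τ⌋ τ` lies in the same slow period as `t`; no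
jump of the hold separates them, and the feedthrough of `G` does no harm. -/
theorem tendsto_io_hold {h : ℝ} (hh : 0 < h) {c : ℕ → ℕ → ℝ} {c' : ℕ → ℝ}
    (hc : Tendsto c atTop (𝓝 c')) {τ : ℕ → ℝ} {N : ℕ → ℕ} (hτ : ∀ᶠ l in atTop, 0 < τ l)
    (hτ0 : Tendsto τ atTop (𝓝 0)) (hN : ∀ᶠ l in atTop, h = N l * τ l) {t : ℝ} (ht : 0 ≤ t) :
    Tendsto (fun l => G.io (hold h (c l)) (⌊t / τ l⌋₊ * τ l)) atTop
      (𝓝 (G.io (hold h c') t)) := by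
  obtain ⟨k, δ, hδ0, hδ, rfl⟩ : ∃ (k : ℕ) (δ : ℝ), 0 ≤ δ ∧ δ < h ∧ t = k * h + δ := by
    refine ⟨⌊t / h⌋₊, t - ⌊t / h⌋₊ * h, ?_, ?_, by ring⟩
    · rw [sub_nonneg, ← le_div_iff₀ hh]; exact Nat.floor_le (by positivity)
    · have := Nat.lt_floor_add_one (t / h)
      rw [div_lt_iff₀ hh] at this
      linarith
  have hcont : Continuous fun p : ℝ × ((Fin G.n → ℝ) × ℝ) => G.response p.1 p.2 := by
    refine (G.out.continuous.comp ((G.continuous_flow.comp (continuous_fst.prodMk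
      (continuous_fst.comp continuous_snd))).add ((continuous_snd.comp continuous_snd).smul
      (G.continuous_stepState.comp continuous_fst)))).add
      (continuous_const.mul (continuous_snd.comp continuous_snd))
  have h1 := (G.continuous_holdState h k).tendsto c' |>.comp hc
  have h2 := (continuous_apply k).tendsto c' |>.comp hc
  have h3 := (hcont.tendsto (δ, G.holdState h c' k, c' k)).comp
    ((tendsto_floor_div_mul hτ hτ0 hδ0).prodMk_nhds (h1.prodMk_nhds h2))
  rw [io_hold hh _ k hδ0 hδ]
  refine h3.congr' ?_
  filter_upwards [hτ, hN] with l hl hNl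
  have h4 : (⌊δ / τ l⌋₊ : ℝ) * τ l ≤ δ := by
    rw [← le_div_iff₀ hl]; exact Nat.floor_le (by positivity)
  rw [floor_div_mul_add hl hNl k hδ0, io_hold hh _ k (by positivity) (h4.trans_lt hδ)]
  rfl

end CTSystem

theorem DTSystem.continuous_io {p q : ℕ} (G : DTSystem p q) (k : ℕ) :
    Continuous fun u : ℕ → Fin p → ℝ => G.io u k := by
  have hs : ∀ k, Continuous fun u : ℕ → Fin p → ℝ => G.state u k := by
    intro k
    induction k with
    | zero => exact continuous_const
    | succ k ih =>
      exact ((Matrix.mulVecLin G.A).continuous_of_finiteDimensional.comp ih).add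
        ((Matrix.mulVecLin G.B).continuous_of_finiteDimensional.comp (continuous_apply k))
  exact ((Matrix.mulVecLin G.C).continuous_of_finiteDimensional.comp (hs k)).add
    ((Matrix.mulVecLin G.D).continuous_of_finiteDimensional.comp (continuous_apply k))

/-- Continuity is for pointwise convergence of sequences: each output value depends on finitely many
inputs, so no stability of the filter is involved. -/
theorem continuous_downsample_filterOp (H₀ : DTSystem 1 1) (q M : ℕ) :
    Continuous fun x => downsample M (filterOp H₀ q x) := by
  refine continuous_pi fun k => ?_
  exact (continuous_apply 0).comp ((H₀.continuous_io (k * M + q)).comp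
    (continuous_pi fun j => continuous_pi fun _ => continuous_apply j))

/-- Sampled outputs of the error system for approximating inputs converge pointwise. -/
theorem tendsto_interp_decimErrorSystem (F P : CTSystem) (hF0 : F.D = 0) (H₀ : DTSystem 1 1)
    (q : ℕ) (M m : ℕ) {h : ℝ} (hh : 0 < h) {τ : ℕ → ℝ} {N : ℕ → ℕ}
    (hτ : ∀ᶠ l in atTop, 0 < τ l) (hτ0 : Tendsto τ atTop (𝓝 0))
    (hN : ∀ᶠ l in atTop, h = N l * τ l) {v : ℕ → ℕ → ℝ} {w : ℝ → ℝ}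
    (hw : MemLp w 2 (volume.restrict (Set.Ici 0)))
    (hlim : Tendsto (fun l => L2Norm (hold (τ l) (v l) - w)) atTop (𝓝 0)) {t : ℝ} (ht : 0 ≤ t) :
    Tendsto (fun l => interp (τ l)
        (decimErrorSystem F P (filterOp H₀ q) M m h (hold (τ l) (v l))) t) atTop
      (𝓝 (decimErrorSystem F P (filterOp H₀ q) M m h w t)) := by
  have hu : ∀ᶠ l in atTop, ∀ a b, IntervalIntegrable (hold (τ l) (v l)) volume a b := by
    filter_upwards [hτ] with l hl
    exact intervalIntegrable_hold hl (v l)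
  have ht' := tendsto_floor_div_mul hτ hτ0 ht
  simp only [interp_apply, decimErrorSystem]
  refine Tendsto.sub ?_ ?_
  -- The switching time `m * h` is a fast sampling instant, so rounding `t` down to the grid never
  -- crosses it.
  · have hiff : ∀ᶠ l in atTop, ((m : ℝ) * h ≤ ⌊t / τ l⌋₊ * τ l ↔ (m : ℝ) * h ≤ t) := by
      filter_upwards [hτ, hN] with l hl hNl
      have e : (m : ℝ) * h = (m * N l : ℕ) * τ l := by
        rw [Nat.cast_mul, mul_assoc, ← hNl]
      rw [e, mul_le_mul_iff_left₀ hl, Nat.cast_le, Nat.le_floor_iff (by positivity),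
        le_div_iff₀ hl]
    by_cases hmt : (m : ℝ) * h ≤ t
    · have h1 := F.tendsto_io hF0 hw hu hlim (s := fun l => ⌊t / τ l⌋₊ * τ l - m * h)
        (hiff.mono fun l hl => sub_nonneg.2 (hl.2 hmt)) (ht'.sub_const _)
      rw [ctDelay, if_pos hmt]
      refine h1.congr' ?_
      filter_upwards [hiff] with l hl
      rw [ctDelay, if_pos (hl.2 hmt)]
    · rw [ctDelay, if_neg hmt]
      refine tendsto_const_nhds.congr' ?_
      filter_upwards [hiff] with l hl
      rw [ctDelay, if_neg (fun h' => hmt (hl.1 h'))]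
  · refine CTSystem.tendsto_io_hold hh ?_ hτ hτ0 hN ht
    refine ((continuous_downsample_filterOp H₀ q M).tendsto _).comp (tendsto_pi_nhds.2 fun k => ?_)
    exact F.tendsto_io hF0 hw hu hlim (Eventually.of_forall fun _ => by positivity)
      tendsto_const_nhds

/-! ### Lower bound by Fatou's lemma and the limit -/

/-- Lower semicontinuity: the induced norm of the error system is at most the limit inferior of the
induced norms of its discretizations. -/
theorem inducedNormL2_le_liminf (F P : CTSystem) (hF0 : F.D = 0) (H₀ : DTSystem 1 1)
    (q : ℕ) {M : ℕ} (hM : 0 < M) (m : ℕ) {h : ℝ} (hh : 0 < h) :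
    inducedNormL2 (decimErrorSystem F P (filterOp H₀ q) M m h)
      ≤ liminf (fun l => inducedNorml2
          (fsfh h (M * l) (decimErrorSystem F P (filterOp H₀ q) M m h))) atTop := by
  set T := decimErrorSystem F P (filterOp H₀ q) M m h with hT
  have hpos : ∀ᶠ l : ℕ in atTop, 0 < M * l :=
    (eventually_gt_atTop 0).mono fun l hl => Nat.mul_pos hM hl
  have hτ : ∀ᶠ l : ℕ in atTop, 0 < h / (M * l : ℕ) :=
    hpos.mono fun l hl => div_pos hh (Nat.cast_pos.2 hl)
  have hN : ∀ᶠ l : ℕ in atTop, h = (M * l : ℕ) * (h / (M * l : ℕ)) :=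
    hpos.mono fun l hl => by
      have : ((M * l : ℕ) : ℝ) ≠ 0 := by exact_mod_cast hl.ne'
      field_simp
  have hτ0 : Tendsto (fun l : ℕ => h / (M * l : ℕ)) atTop (𝓝 0) :=
    tendsto_const_nhds.div_atTop (tendsto_natCast_atTop_atTop.comp
      (tendsto_id.const_mul_atTop' hM))
  refine iSup_le fun w => iSup_le fun hw => iSup_le fun hw0 => ?_
  have hw1 : L2Norm w ≠ ∞ := hw.eLpNorm_ne_top
  obtain ⟨v, hv⟩ := exists_tendsto_hold hτ hτ0 hw
  have hnorm := tendsto_L2Norm (fun l => (measurable_hold _ (v l)).aestronglyMeasurable) hw hv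
  have hfatou : L2Norm (T w) ^ 2 ≤ liminf (fun l : ℕ => L2Norm
      (interp (h / (M * l : ℕ)) (T (hold (h / (M * l : ℕ)) (v l)))) ^ 2) atTop := by
    simp only [L2Norm_sq]
    refine le_trans (le_of_eq ?_) (lintegral_liminf_le fun l =>
      ((measurable_interp _ _).enorm.pow_const 2))
    refine setLIntegral_congr_fun measurableSet_Ici fun t ht => ?_
    have h1 := tendsto_interp_decimErrorSystem F P hF0 H₀ q M m hh hτ hτ0 hN hw hv ht
    exact (((ENNReal.continuous_pow 2).tendsto _).comp
      ((continuous_enorm.tendsto _).comp h1)).liminf_eq.symm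
  rw [ENNReal.div_le_iff hw0 hw1]
  -- A bound `B` strictly below `‖T w‖` is finite, which covers `‖T w‖ = ∞` and makes `B / ‖·‖`
  -- continuous along the norms of the approximants.
  refine le_of_forall_lt_imp_le_of_dense fun B hB => ?_
  have hev := eventually_lt_of_lt_liminf
    (((ENNReal.pow_right_strictMono two_ne_zero) hB).trans_le hfatou)
  rw [← ENNReal.div_le_iff hw0 hw1]
  have hdiv : Tendsto (fun l : ℕ => B / L2Norm (hold (h / (M * l : ℕ)) (v l))) atTop
      (𝓝 (B / L2Norm w)) := ENNReal.Tendsto.const_div hnorm (Or.inr hB.ne_top)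
  rw [← hdiv.liminf_eq]
  refine liminf_le_liminf ?_
  filter_upwards [hev, hpos, hnorm.eventually_ne hw0, hnorm.eventually_ne hw1] with l h1 h2 h3 h4
  rw [ENNReal.div_le_iff h3 h4]
  refine le_trans ?_ (L2Norm_interp_le hh h2 T (v l) h4 h3)
  exact (sq_le_sq_ennreal.1 h1.le)

theorem tendsto_inducedNorml2_fsfh (F P : CTSystem) (hF : F.IsStable) (hF0 : F.D = 0)
    (H₀ : DTSystem 1 1) (q : ℕ) {M : ℕ} (hM : 0 < M) (m : ℕ) {h : ℝ} (hh : 0 < h) :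
    Tendsto (fun l => inducedNorml2
        (fsfh h (M * l) (decimErrorSystem F P (filterOp H₀ q) M m h))) atTop
      (𝓝 (inducedNormL2 (decimErrorSystem F P (filterOp H₀ q) M m h))) := by
  refine tendsto_of_le_liminf_of_limsup_le (inducedNormL2_le_liminf F P hF0 H₀ q hM m hh) ?_
  obtain ⟨C, hC, hb⟩ := exists_inducedNorml2_le F P hF (filterOp H₀ q) M m hh
  set c := inducedNormL2 (decimErrorSystem F P (filterOp H₀ q) M m h) with hc
  -- For an infinite gain the limsup bound is trivial and the limit comes from the liminf bound
  -- alone; a finite `c` makes the error term tend to `0`.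
  rcases eq_or_ne c ∞ with htop | htop
  · rw [htop]; exact le_top
  have hτ0 : Tendsto (fun l : ℕ => C * (h / (M * l : ℕ))) atTop (𝓝 0) := by
    have := (tendsto_const_nhds (x := h)).div_atTop (tendsto_natCast_atTop_atTop (R := ℝ).comp
      (tendsto_id.const_mul_atTop' hM))
    simpa using this.const_mul C
  have h1 : Tendsto (fun l : ℕ => c + ENNReal.ofReal (C * (h / (M * l : ℕ))) * (c + 1)) atTop
      (𝓝 c) := by
    have h2 := ENNReal.Tendsto.mul_const (b := c + 1) (ENNReal.tendsto_ofReal hτ0)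
      (Or.inr (by simp [htop]))
    simpa using h2.const_add c
  rw [← h1.limsup_eq]
  refine limsup_le_limsup ?_
  filter_upwards [eventually_gt_atTop 0] with l hl
  exact hb (M * l) (Nat.mul_pos hM hl)

theorem mainTheorem6
    (F P : CTSystem) (hF : F.IsStable) (hF0 : F.D = 0) (hP : P.IsStable)
    (M m : ℕ) (hM : 0 < M) (h : ℝ) (hh : 0 < h)
    (H₀ : DTSystem 1 1) (q : ℕ) (hq : q < M) :
    -- the lifting identities and the reduction to a single-rate system
    (∀ x : ℕ → ℝ, downsample M (filterOp H₀ q x)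
        = liftedFilter M (filterOp H₀ q) (dlift M x)) ∧
    (∃ Hs : DTSystem M 1, ∀ (v : ℕ → Fin M → ℝ) (k : ℕ),
        Hs.io v k 0 = liftedFilter M (filterOp H₀ q) v k) ∧
    (∀ u : ℝ → ℝ, dlift M (sampler (h / M) u) = gsampler h M u) ∧
    decimErrorSystem F P (filterOp H₀ q) M m h
        = singleRateSystem F P (liftedFilter M (filterOp H₀ q)) m h ∧
    -- the finite-dimensional fast-sampling/fast-hold discretizations, `N = M l`
    ∃ T : (N : ℕ) → DTSystem N N,
      (∀ l : ℕ, 0 < l →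
        (T (M * l)).io = decimDiscretization F P (filterOp H₀ q) M l m h ∧
        (T (M * l)).io = fsfh h (M * l) (decimErrorSystem F P (filterOp H₀ q) M m h)) ∧
      Tendsto (fun l : ℕ => inducedNorml2 (T (M * l)).io) atTop
        (𝓝 (inducedNormL2 (decimErrorSystem F P (filterOp H₀ q) M m h))) := by

  refine ⟨downsample_eq_liftedFilter _ hM, ?_, dlift_sampler_eq_gsampler hM h,
    decimErrorSystem_eq_singleRateSystem F P _ hM m h, ?_⟩
  · obtain ⟨Hs, hHs⟩ := ((Realizable.static
      (LinearMap.pi fun _ => LinearMap.id : ℝ →ₗ[ℝ] (Fin 1 → ℝ))).comp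
      (Realizable.liftedFilter H₀ hq)).exists_dtSystem
    exact ⟨Hs, fun v k => by rw [hHs]; rfl⟩
  · have hreal : ∀ l : ℕ, 0 < l → ∃ G : DTSystem (M * l) (M * l),
        G.io = fsfh h (M * l) (decimErrorSystem F P (filterOp H₀ q) M m h) := fun l hl => by
      rw [← decimDiscretization_eq_fsfh F P _ m hh hM hl]
      exact (Realizable.decimDiscretization F P H₀ m hh hq hl).exists_dtSystem
    classical
    -- Only positive multiples of `M` matter; where no realization exists, the zero system without
    -- states is a default.
    let T : (N : ℕ) → DTSystem N N := fun N =>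
      if hex : ∃ G : DTSystem N N,
        G.io = fsfh h N (decimErrorSystem F P (filterOp H₀ q) M m h)
      then hex.choose else ⟨0, 0, 0, 0, 0⟩
    have hT : ∀ l : ℕ, 0 < l → (T (M * l)).io
        = fsfh h (M * l) (decimErrorSystem F P (filterOp H₀ q) M m h) := fun l hl => by
      simp only [T, dif_pos (hreal l hl)]
      exact (hreal l hl).choose_spec
    refine ⟨T, fun l hl => ⟨?_, hT l hl⟩, ?_⟩
    · rw [hT l hl, decimDiscretization_eq_fsfh F P _ m hh hM hl]
    · refine (tendsto_inducedNorml2_fsfh F P hF hF0 H₀ q hM m hh).congr' ?_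
      filter_upwards [eventually_gt_atTop 0] with l hl
      rw [hT l hl]
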